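/- Let $G=E_{6(6)}$ (type EI) be the connected centreless split real form of type $E_6$, with maximal compact subgroup $K$, complexified Cartan decomposition $\mathfrak g=\mathfrak k\oplus\mathfrak p$ with complexified Cartan involution $\theta$, and $\theta$-stable fundamental Cartan subalgebra $\mathfrak h_f=\mathfrak t_f\oplus\mathfrak a_f$. Let $\beta_1,\dots,\beta_6$ be the simple roots of a compatible positive system $\Delta^+(\mathfrak g,\mathfrak h_f)$ (Bourbaki labelling; $\theta$ interchanges $\beta_1\leftrightarrow\beta_6$ and $\beta_3\leftrightarrow\beta_5$, $\beta_2$ is noncompact and $\beta_4$ is compact). Put $\alpha_1=\frac12(\beta_1+\beta_6)$, $\alpha_2=\frac12(\beta_3+\beta_5)$, $\alpha_3=\beta_4$, $\alpha_4=\beta_2$; these are the simple roots of $\Delta^+(\mathfrak g,\mathfrak t_f)$ (type $F_4$). The simple roots of $\Delta^+(\mathfrak k,\mathfrak t_f)$ (type $C_4$) are $\gamma_1=\alpha_2+\alpha_3+\alpha_4$, $\gamma_2=\alpha_1$, $\gamma_3=\alpha_2$, $\gamma_4=\alpha_3$, with fundamental weights $\varpi_1,\dots,\varpi_4$. Write $[p,q,r,s]$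 for the $K$-type with highest weight $p\varpi_1+q\varpi_2+r\varpi_3+s\varpi_4$; the $K$-types are exactly the $[p,q,r,s]$ with $p,q,r,s\in\mathbb N=\{0,1,2,\dots\}$ and $p+r$ even. Let $\rho_c$ be the half sum of $\Delta^+(\mathfrak k,\mathfrak t_f)$, and let $\|\cdot\|$ be the norm induced by a nondegenerate invariant symmetric bilinear form on $\mathfrak g$ (normalised to be positive definite on the real span of the roots, in which $\mathfrak t_f^*$ is embedded by extending functionals by zero on $\mathfrak a_f$). For a $K$-type with highest weight $\mu$: * its lambda norm is $\|\lambda_a(\mu)\|$, where $\lambda_a(\mu)$ is the projection of $\mu+2\rho_c-\rho'$ to the (closed) dominant Weyl chamber of a positive system $(\Delta^+)'(\mathfrak g,\mathfrak h_f)$ making $\mu+2\rho_c$ dominant, and $\rho'$ is the half sum of this positive system (the number does not depend on its choice); * its spin norm is $\min_j\|\{\mu-\rho_n^{(j)}\}+\rho_c\|$, where $\rho_n^{(j)}$ runs over the half sums of the roots of $\Delta(\mathfrak p,\mathfrak t_f)$ that lie in a positive system of $\Delta(\mathfrak g,\mathfrak t_f)$ containing $\Delta^+(\mathfrak k,\mathfrak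 t_f)$, and $\{\nu\}$ is the dominant weight in the $W(\mathfrak k,\mathfrak t_f)$-orbit of $\nu$. Then the $K$-types whose spin norm is equal to their lambda norm are exactly those of one of the three forms $$[c+2d+e+2,\ a+f,\ c+e,\ b+d],$$ $$[2b+c+2d+e+4,\ a+f,\ c+e,\ d-1]\quad\text{with } d\ge 1,$$ $$[c+e,\ a+f,\ c+2d+e+2,\ b-1]\quad\text{with } b\ge 1,$$ where $a,b,c,d,e,f\in\mathbb N$ satisfy $a-f\in\{0,1\}$, $c-e\in\{0,1\}$, $a+f\ge1$, $c+e\ge1$ and $b+d\ge1$. -/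

import Mathlib

/-
The data attached to the centreless connected split real group `EI = E_{6(6)}`: the complex simple
Lie algebra `𝔤` of type `E₆` with its (complexified) Cartan involution, the fundamental Cartan
subalgebra `𝔥_f = 𝔱_f ⊕ 𝔞_f`, the root systems `Δ(𝔤, 𝔥_f)`, `Δ(𝔤, 𝔱_f)`, `Δ(𝔨, 𝔱_f)`,
`Δ(𝔭, 𝔱_f)`, and the lambda norm and the spin norm of a `K`-type. The nodes of the Dynkin diagram
are numbered as by Bourbaki: the chain is 1, 3, 4, 5, 6, and 2 is attached to 4. In Lean they are
numbered from 0.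
-/

namespace EI

/-- The symmetric bilinear form on `R⁶` whose Gram matrix is the Cartan matrix of type `E₆`. -/
def form {R : Type*} [CommRing R] (x y : Fin 6 → R) : R :=
  ∑ i, ∑ j, x i * (CartanMatrix.E₆ i j : R) * y j

/-- The nontrivial automorphism `1 ↔ 6, 3 ↔ 5` of the Dynkin diagram `E₆` (nodes numbered from 0). -/
def tau : Fin 6 → Fin 6 := ![5, 1, 4, 3, 2, 0]

/-- The root system `E₆`: vectors of square length two in the root lattice; `α` stands for
`∑ i, α i • β i`, where `β` are the simple roots. -/
abbrev Root : Type := {α : Fin 6 → ℤ // form α α = 2}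

/-- A bilinear form on the root lattice with `ori α α = (α, α) / 2` and
`ori α β + ori β α = (α, β)`; it comes from an orientation of the Dynkin diagram that is
invariant under `tau`. -/
def ori (α β : Fin 6 → ℤ) : ℤ :=
  ∑ i, α i * β i - α 0 * β 2 - α 2 * β 3 - α 5 * β 4 - α 4 * β 3 - α 1 * β 3

/-- The cocycle `(-1) ^ ori α β`. -/
noncomputable def eps (α β : Fin 6 → ℤ) : ℂ := (-1) ^ ori α β

lemma form_int (x y : Fin 6 → ℤ) : form x y =
    2 * (x 0 * y 0 + x 1 * y 1 + x 2 * y 2 + x 3 * y 3 + x 4 * y 4 + x 5 * y 5)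
     - x 0 * y 2 - x 2 * y 0 - x 2 * y 3 - x 3 * y 2 - x 3 * y 4 - x 4 * y 3
     - x 4 * y 5 - x 5 * y 4 - x 1 * y 3 - x 3 * y 1 := by
  simp [form, CartanMatrix.E₆, Fin.sum_univ_six]; ring

lemma form_sos (x : Fin 6 → ℤ) : 30 * form x x =
    15 * (2 * x 0 - x 2) ^ 2 + 15 * (2 * x 1 - x 3) ^ 2 + 15 * (2 * x 5 - x 4) ^ 2 +
    5 * (3 * x 2 - 2 * x 3) ^ 2 + 5 * (3 * x 4 - 2 * x 3) ^ 2 + 5 * (x 3) ^ 2 := by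
  rw [form_int]; ring

lemma form_nonneg (x : Fin 6 → ℤ) : 0 ≤ form x x := by
  have := form_sos x
  have h : 0 ≤ 30 * form x x := by rw [this]; positivity
  omega

lemma form_eq_zero {x : Fin 6 → ℤ} (h : form x x = 0) : x = 0 := by
  have e := form_sos x
  rw [h] at e
  have h0 := sq_nonneg (2 * x 0 - x 2)
  have h1 := sq_nonneg (2 * x 1 - x 3)
  have h2 := sq_nonneg (2 * x 5 - x 4)
  have h3 := sq_nonneg (3 * x 2 - 2 * x 3)
  have h4 := sq_nonneg (3 * x 4 - 2 * x 3)
  have h5 := sq_nonneg (x 3)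
  have z0 : 2 * x 0 - x 2 = 0 := pow_eq_zero_iff two_ne_zero |>.1 (by linarith)
  have z1 : 2 * x 1 - x 3 = 0 := pow_eq_zero_iff two_ne_zero |>.1 (by linarith)
  have z2 : 2 * x 5 - x 4 = 0 := pow_eq_zero_iff two_ne_zero |>.1 (by linarith)
  have z3 : 3 * x 2 - 2 * x 3 = 0 := pow_eq_zero_iff two_ne_zero |>.1 (by linarith)
  have z4 : 3 * x 4 - 2 * x 3 = 0 := pow_eq_zero_iff two_ne_zero |>.1 (by linarith)
  have z5 : x 3 = 0 := pow_eq_zero_iff two_ne_zero |>.1 (by linarith)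
  funext i
  fin_cases i <;> simp <;> omega

lemma form_add_left {R : Type*} [CommRing R] (x y z : Fin 6 → R) :
    form (x + y) z = form x z + form y z := by
  simp [form, add_mul, Finset.sum_add_distrib]

lemma form_add_right {R : Type*} [CommRing R] (x y z : Fin 6 → R) :
    form x (y + z) = form x y + form x z := by
  simp [form, mul_add, Finset.sum_add_distrib]

lemma form_smul_left {R : Type*} [CommRing R] (c : R) (x y : Fin 6 → R) :
    form (c • x) y = c * form x y := by
  simp [form, Finset.mul_sum, mul_assoc]

lemma form_smul_right {R : Type*} [CommRing R] (c : R) (x y : Fin 6 → R) :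
    form x (c • y) = c * form x y := by
  simp only [form, Finset.mul_sum, Pi.smul_apply, smul_eq_mul]
  exact Finset.sum_congr rfl fun i _ => Finset.sum_congr rfl fun j _ => by ring

lemma form_comm {R : Type*} [CommRing R] (x y : Fin 6 → R) : form x y = form y x := by
  simp [form, CartanMatrix.E₆, Fin.sum_univ_six]; ring

lemma form_neg_left {R : Type*} [CommRing R] (x y : Fin 6 → R) : form (-x) y = -form x y := by
  simp [form]

lemma form_neg_right {R : Type*} [CommRing R] (x y : Fin 6 → R) : form x (-y) = -form x y := by
  simp [form]

lemma form_tau {R : Type*} [CommRing R] (x y : Fin 6 → R) :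
    form (fun i => x (tau i)) (fun i => y (tau i)) = form x y := by
  simp [form, CartanMatrix.E₆, Fin.sum_univ_six, tau]; ring

lemma tau_tau (i : Fin 6) : tau (tau i) = i := by fin_cases i <;> rfl

lemma eps_add_left (α β γ : Fin 6 → ℤ) : eps (α + β) γ = eps α γ * eps β γ := by
  rw [eps, eps, eps, ← zpow_add₀ (by norm_num)]
  congr 1; simp [ori, Fin.sum_univ_six]; ring

lemma eps_add_right (α β γ : Fin 6 → ℤ) : eps α (β + γ) = eps α β * eps α γ := by
  rw [eps, eps, eps, ← zpow_add₀ (by norm_num)]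
  congr 1; simp [ori, Fin.sum_univ_six]; ring

lemma eps_mul_self (α β : Fin 6 → ℤ) : eps α β * eps α β = 1 := by
  rw [eps, ← mul_zpow]; simp

lemma eps_neg_left (α β : Fin 6 → ℤ) : eps (-α) β = eps α β := by
  have : ori (-α) β = -ori α β := by simp [ori, Fin.sum_univ_six]; ring
  rw [eps, eps, this, zpow_neg, ← inv_zpow]; norm_num

lemma eps_neg_right (α β : Fin 6 → ℤ) : eps α (-β) = eps α β := by
  have : ori α (-β) = -ori α β := by simp [ori, Fin.sum_univ_six]; ring
  rw [eps, eps, this, zpow_neg, ← inv_zpow]; norm_num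

lemma eps_swap (α β : Fin 6 → ℤ) : eps β α = (-1) ^ form α β * eps α β := by
  have h : ori β α = form α β - ori α β := by
    rw [form_int]; simp [ori, Fin.sum_univ_six]; ring
  rw [eps, eps, h, sub_eq_add_neg, zpow_add₀ (by norm_num), zpow_neg, ← inv_zpow]; norm_num

lemma eps_self {α : Fin 6 → ℤ} (h : form α α = 2) : eps α α = -1 := by
  have h : ori α α = 1 := by
    rw [form_int] at h; simp [ori, Fin.sum_univ_six]; linarith
  rw [eps, h, zpow_one]

lemma eps_tau (α β : Fin 6 → ℤ) :
    eps (fun i => α (tau i)) (fun i => β (tau i)) = eps α β := by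
  rw [eps, eps]; congr 1; simp [ori, Fin.sum_univ_six, tau]; ring

lemma root_bound {α : Fin 6 → ℤ} (h : form α α = 2) (i : Fin 6) : α i ∈ Finset.Icc (-4 : ℤ) 4 := by
  have e := form_sos α
  rw [h] at e
  have h0 := sq_nonneg (2 * α 0 - α 2)
  have h1 := sq_nonneg (2 * α 1 - α 3)
  have h2 := sq_nonneg (2 * α 5 - α 4)
  have h3 := sq_nonneg (3 * α 2 - 2 * α 3)
  have h4 := sq_nonneg (3 * α 4 - 2 * α 3)
  have h5 := sq_nonneg (α 3)
  have b0 := abs_le_of_sq_le_sq (a := 2 * α 0 - α 2) (b := 2) (by linarith) (by norm_num)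
  have b1 := abs_le_of_sq_le_sq (a := 2 * α 1 - α 3) (b := 2) (by linarith) (by norm_num)
  have b2 := abs_le_of_sq_le_sq (a := 2 * α 5 - α 4) (b := 2) (by linarith) (by norm_num)
  have b3 : |3 * α 2 - 2 * α 3| ≤ 4 := abs_le_of_sq_le_sq (by linarith) (by norm_num)
  have b4 : |3 * α 4 - 2 * α 3| ≤ 4 := abs_le_of_sq_le_sq (by linarith) (by norm_num)
  have b5 : |α 3| ≤ 4 := abs_le_of_sq_le_sq (by linarith) (by norm_num)
  rw [abs_le] at b3 b4 b5
  rw [abs_le] at b0 b1 b2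
  rw [Finset.mem_Icc]
  fin_cases i <;> simp <;> omega

lemma finite_root : {α : Fin 6 → ℤ | form α α = 2}.Finite :=
  (Set.finite_Icc (fun _ => (-4 : ℤ)) (fun _ => 4)).subset fun _ h =>
    ⟨fun i => (Finset.mem_Icc.1 (root_bound h i)).1, fun i => (Finset.mem_Icc.1 (root_bound h i)).2⟩

noncomputable instance : Fintype Root := finite_root.fintype

instance : Neg Root := ⟨fun α => ⟨-α.1, by rw [form_neg_left, form_neg_right, neg_neg, α.2]⟩⟩

lemma neg_neg_root (α : Root) : - -α = α := Subtype.ext (neg_neg (G := Fin 6 → ℤ) α.1)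

/-- The action of the diagram automorphism on roots. -/
def tauRoot (α : Root) : Root := ⟨fun i => α.1 (tau i), by rw [form_tau, α.2]⟩

/-- The underlying space of the complex Lie algebra of type `E₆`: a Cartan subalgebra, written in
the basis of simple coroots, plus one coordinate for every root. -/
@[ext] structure LieE6 where
  /-- The component in the Cartan subalgebra. -/
  fst : Fin 6 → ℂ
  /-- The coefficients of the root vectors. -/
  snd : Root → ℂ

namespace LieE6

instance : Zero LieE6 := ⟨⟨0, 0⟩⟩
instance : Add LieE6 := ⟨fun x y => ⟨x.1 + y.1, x.2 + y.2⟩⟩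
instance : Neg LieE6 := ⟨fun x => ⟨-x.1, -x.2⟩⟩
instance : Sub LieE6 := ⟨fun x y => ⟨x.1 - y.1, x.2 - y.2⟩⟩
instance : SMul ℕ LieE6 := ⟨fun n x => ⟨n • x.1, n • x.2⟩⟩
instance : SMul ℤ LieE6 := ⟨fun n x => ⟨n • x.1, n • x.2⟩⟩
noncomputable instance : SMul ℂ LieE6 := ⟨fun c x => ⟨c • x.1, c • x.2⟩⟩

/-- The pair of components. -/
def toProd (x : LieE6) : (Fin 6 → ℂ) × (Root → ℂ) := (x.1, x.2)

lemma toProd_injective : Function.Injective toProd := fun _ _ h =>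
  LieE6.ext (congrArg Prod.fst h) (congrArg Prod.snd h)

noncomputable instance : AddCommGroup LieE6 :=
  toProd_injective.addCommGroup toProd rfl (fun _ _ => rfl) (fun _ => rfl) (fun _ _ => rfl)
    (fun _ _ => rfl) (fun _ _ => rfl)

noncomputable instance : Module ℂ LieE6 :=
  toProd_injective.module ℂ
    { toFun := toProd, map_zero' := rfl, map_add' := fun _ _ => rfl } (fun _ _ => rfl)

end LieE6

/-- The value of the root `α` at the element `h` of the Cartan subalgebra. -/
noncomputable def rootEval (α : Fin 6 → ℤ) : (Fin 6 → ℂ) →ₗ[ℂ] ℂ where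
  toFun h := form (fun i => (α i : ℂ)) h
  map_add' := form_add_right _
  map_smul' c h := form_smul_right c _ h

lemma rootEval_apply (α : Fin 6 → ℤ) (h : Fin 6 → ℂ) :
    rootEval α h = form (fun i => (α i : ℂ)) h := rfl

/-- The bracket of the simply laced Lie algebra: for `h, h'` in the Cartan subalgebra,
`[h, h'] = 0`, `[h, e_α] = α(h) e_α`, `[e_α, e_{-α}] = eps α (-α) α^∨`,
`[e_α, e_β] = eps α β e_{α+β}` if `α + β` is a root, and `[e_α, e_β] = 0` otherwise. -/
noncomputable instance : Bracket LieE6 LieE6 where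
  bracket x y :=
    ⟨∑ α : Root, (x.2 α * y.2 (-α) * eps α.1 (-α.1)) • (fun i => (α.1 i : ℂ)),
     fun γ => rootEval γ.1 x.1 * y.2 γ - rootEval γ.1 y.1 * x.2 γ +
       ∑ α : Root, ∑ β : Root, if α.1 + β.1 = γ.1 then eps α.1 β.1 * (x.2 α * y.2 β) else 0⟩

/-- The inclusion of the Cartan subalgebra. -/
noncomputable def cartan : (Fin 6 → ℂ) →ₗ[ℂ] LieE6 where
  toFun h := ⟨h, 0⟩
  map_add' _ _ := LieE6.ext rfl (add_zero (0 : Root → ℂ)).symm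
  map_smul' c _ := LieE6.ext rfl (smul_zero (A := Root → ℂ) c).symm

/-- The root vector `e_v` if `v` is a root, and zero otherwise. -/
noncomputable def rootVec (v : Fin 6 → ℤ) : LieE6 :=
  open scoped Classical in ⟨0, fun γ => if γ.1 = v then 1 else 0⟩

@[simp] lemma fst_add (x y : LieE6) : (x + y).1 = x.1 + y.1 := rfl
@[simp] lemma snd_add (x y : LieE6) : (x + y).2 = x.2 + y.2 := rfl
@[simp] lemma fst_smul (c : ℂ) (x : LieE6) : (c • x).1 = c • x.1 := rfl
@[simp] lemma snd_smul (c : ℂ) (x : LieE6) : (c • x).2 = c • x.2 := rfl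
@[simp] lemma fst_zero : (0 : LieE6).1 = 0 := rfl
@[simp] lemma snd_zero : (0 : LieE6).2 = 0 := rfl
@[simp] lemma fst_cartan (h : Fin 6 → ℂ) : (cartan h).1 = h := rfl
@[simp] lemma snd_cartan (h : Fin 6 → ℂ) : (cartan h).2 = 0 := rfl
@[simp] lemma fst_rootVec (v : Fin 6 → ℤ) : (rootVec v).1 = 0 := rfl

lemma fst_lie (x y : LieE6) : ⁅x, y⁆.1 =
    ∑ α : Root, (x.2 α * y.2 (-α) * eps α.1 (-α.1)) • (fun i => (α.1 i : ℂ)) := rfl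

lemma snd_lie (x y : LieE6) (γ : Root) : ⁅x, y⁆.2 γ =
    rootEval γ.1 x.1 * y.2 γ - rootEval γ.1 y.1 * x.2 γ +
       ∑ α : Root, ∑ β : Root,
         if α.1 + β.1 = γ.1 then eps α.1 β.1 * (x.2 α * y.2 β) else 0 := rfl

lemma snd_rootVec (v : Fin 6 → ℤ) (γ : Root) [Decidable (γ.1 = v)] :
    (rootVec v).2 γ = if γ.1 = v then 1 else 0 := by
  classical
  simp only [rootVec]; congr

lemma snd_rootVec' (α γ : Root) : (rootVec α.1).2 γ = if γ = α then 1 else 0 := by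
  classical
  rw [snd_rootVec]; congr 1; exact propext Subtype.ext_iff.symm

lemma rootVec_of_ne {v : Fin 6 → ℤ} (h : form v v ≠ 2) : rootVec v = 0 := by
  classical
  refine LieE6.ext rfl (funext fun γ => ?_)
  rw [snd_rootVec, if_neg]; · rfl
  rintro rfl; exact h γ.2

lemma lie_add_aux (x y z : LieE6) : ⁅x, y + z⁆ = ⁅x, y⁆ + ⁅x, z⁆ := by
  refine LieE6.ext ?_ (funext fun γ => ?_)
  · rw [fst_add, fst_lie, fst_lie, fst_lie, ← Finset.sum_add_distrib]
    refine Finset.sum_congr rfl fun α _ => ?_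
    rw [← add_smul, snd_add, Pi.add_apply]; congr 1; ring
  · have : (∑ α : Root, ∑ β : Root,
         if α.1 + β.1 = γ.1 then eps α.1 β.1 * (x.2 α * (y + z).2 β) else 0) =
       (∑ α : Root, ∑ β : Root,
         if α.1 + β.1 = γ.1 then eps α.1 β.1 * (x.2 α * y.2 β) else 0) +
       (∑ α : Root, ∑ β : Root,
         if α.1 + β.1 = γ.1 then eps α.1 β.1 * (x.2 α * z.2 β) else 0) := by
      rw [← Finset.sum_add_distrib]
      refine Finset.sum_congr rfl fun α _ => ?_
      rw [← Finset.sum_add_distrib]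
      refine Finset.sum_congr rfl fun β _ => ?_
      rw [snd_add, Pi.add_apply]
      split_ifs <;> ring
    rw [snd_add, Pi.add_apply, snd_lie, snd_lie, snd_lie, this, fst_add, snd_add, map_add,
      Pi.add_apply]
    ring

lemma lie_smul_aux (c : ℂ) (x y : LieE6) : ⁅x, c • y⁆ = c • ⁅x, y⁆ := by
  refine LieE6.ext ?_ (funext fun γ => ?_)
  · rw [fst_smul, fst_lie, fst_lie, Finset.smul_sum]
    refine Finset.sum_congr rfl fun α _ => ?_
    rw [smul_smul, snd_smul, Pi.smul_apply, smul_eq_mul]; congr 1; ring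
  · have : (∑ α : Root, ∑ β : Root,
         if α.1 + β.1 = γ.1 then eps α.1 β.1 * (x.2 α * (c • y).2 β) else 0) =
       c * (∑ α : Root, ∑ β : Root,
         if α.1 + β.1 = γ.1 then eps α.1 β.1 * (x.2 α * y.2 β) else 0) := by
      rw [Finset.mul_sum]
      refine Finset.sum_congr rfl fun α _ => ?_
      rw [Finset.mul_sum]
      refine Finset.sum_congr rfl fun β _ => ?_
      rw [snd_smul, Pi.smul_apply, smul_eq_mul]
      split_ifs <;> ring
    rw [snd_smul, Pi.smul_apply, snd_lie, snd_lie, this, fst_smul, snd_smul, map_smul,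
      Pi.smul_apply, smul_eq_mul, smul_eq_mul, smul_eq_mul]
    ring

lemma lie_skew_aux (x y : LieE6) : ⁅y, x⁆ = -⁅x, y⁆ := by
  refine LieE6.ext ?_ (funext fun γ => ?_)
  · change _ = -(⁅x, y⁆.1)
    rw [fst_lie, fst_lie, ← Finset.sum_neg_distrib]
    refine Fintype.sum_equiv ⟨Neg.neg, Neg.neg, neg_neg_root, neg_neg_root⟩ _ _ fun α => ?_
    have h1 : (-α).1 = -α.1 := rfl
    have h2 : - -α = α := neg_neg_root α
    simp only [Equiv.coe_fn_mk]
    rw [h2, h1, neg_neg, eps_neg_left, eps_neg_right]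
    funext i
    simp only [Pi.smul_apply, Pi.neg_apply, smul_eq_mul, Int.cast_neg]
    ring
  · change _ = -(⁅x, y⁆.2 γ)
    have : (∑ α : Root, ∑ β : Root,
         if α.1 + β.1 = γ.1 then eps α.1 β.1 * (y.2 α * x.2 β) else 0) =
       - (∑ α : Root, ∑ β : Root,
         if α.1 + β.1 = γ.1 then eps α.1 β.1 * (x.2 α * y.2 β) else 0) := by
      rw [Finset.sum_comm, ← Finset.sum_neg_distrib]
      refine Finset.sum_congr rfl fun α _ => ?_
      rw [← Finset.sum_neg_distrib]
      refine Finset.sum_congr rfl fun β _ => ?_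
      rw [add_comm β.1]
      split_ifs with h
      · have hf : form α.1 β.1 = -1 := by
          have := γ.2
          rw [← h, form_add_left, form_add_right, form_add_right, α.2, β.2,
            form_comm β.1 α.1] at this
          omega
        have h1 : (-1 : ℂ) ^ (-1 : ℤ) = -1 := by norm_num
        rw [eps_swap α.1 β.1, hf, h1]; ring
      · simp
    rw [snd_lie, snd_lie, this]; ring

lemma add_lie_aux (x y z : LieE6) : ⁅x + y, z⁆ = ⁅x, z⁆ + ⁅y, z⁆ := by
  rw [lie_skew_aux z, lie_add_aux, lie_skew_aux z x, lie_skew_aux z y, neg_add]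

lemma smul_lie_aux (c : ℂ) (x y : LieE6) : ⁅c • x, y⁆ = c • ⁅x, y⁆ := by
  rw [lie_skew_aux y, lie_smul_aux, lie_skew_aux y x, smul_neg]

lemma lie_HH (h h' : Fin 6 → ℂ) : ⁅cartan h, cartan h'⁆ = 0 := by
  refine LieE6.ext ?_ (funext fun γ => ?_)
  · rw [fst_lie]; simp
  · rw [snd_lie]; simp

lemma lie_HE (h : Fin 6 → ℂ) (v : Fin 6 → ℤ) :
    ⁅cartan h, rootVec v⁆ = rootEval v h • rootVec v := by
  classical
  refine LieE6.ext ?_ (funext fun γ => ?_)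
  · rw [fst_lie]; simp
  · rw [snd_lie]; simp only [snd_cartan, fst_cartan, snd_smul, fst_rootVec, Pi.smul_apply,
      snd_rootVec]
    by_cases hv : γ.1 = v <;> simp [hv]

/-- `⁅e_α, e_β⁆` for roots `α, β`. -/
lemma lie_EE (α β : Root) : ⁅rootVec α.1, rootVec β.1⁆ =
    eps α.1 β.1 • (if α.1 + β.1 = 0 then cartan (fun i => (α.1 i : ℂ))
      else rootVec (α.1 + β.1)) := by
  classical
  refine LieE6.ext ?_ (funext fun γ => ?_)
  · rw [fst_lie, Finset.sum_eq_single α]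
    · simp only [snd_rootVec']
      by_cases h : α.1 + β.1 = 0
      · have hb : -α = β := Subtype.ext (neg_eq_of_add_eq_zero_right h)
        have hb' : -α.1 = β.1 := neg_eq_of_add_eq_zero_right h
        simp [h, hb, hb']
      · have hb : -α ≠ β := fun e => h (by rw [← e]; exact add_neg_cancel α.1)
        simp [h, hb]
    · intro b _ hb
      simp [snd_rootVec', hb]
    · simp
  · rw [snd_lie, Finset.sum_eq_single α, Finset.sum_eq_single β]
    · simp only [snd_rootVec', fst_rootVec]
      by_cases h : α.1 + β.1 = 0
      · have : γ.1 ≠ 0 := fun e => by have := γ.2; rw [e] at this; simp [form] at this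
        simp [h, this.symm]
      · simp [h, snd_rootVec, eq_comm]
    · intro b _ hb
      simp [snd_rootVec', hb]
    · simp
    · intro b _ hb
      simp [snd_rootVec', hb]
    · simp

lemma form_cast (α β : Fin 6 → ℤ) : rootEval α (fun i => (β i : ℂ)) = (form α β : ℤ) := by
  simp [rootEval, form]

lemma rootEval_add (α β : Fin 6 → ℤ) (h : Fin 6 → ℂ) :
    rootEval (α + β) h = rootEval α h + rootEval β h := by
  have e : (fun i => (((α + β) i : ℤ) : ℂ)) = (fun i => (α i : ℂ)) + fun i => (β i : ℂ) := by
    funext i; simp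
  rw [rootEval_apply, rootEval_apply, rootEval_apply, e, form_add_left]

lemma lie_EH (α h) : ⁅rootVec α, cartan h⁆ = -(rootEval α h • rootVec α) := by
  rw [lie_skew_aux, lie_HE]

lemma form_sum (x y : Fin 6 → ℤ) :
    form (x + y) (x + y) = form x x + form y y + 2 * form x y := by
  rw [form_add_left, form_add_right, form_add_right, form_comm y x]; ring

lemma root_ge (α β : Root) : -2 ≤ form α.1 β.1 := by
  have := form_nonneg (α.1 + β.1)
  rw [form_sum, α.2, β.2] at this; omega

lemma root_le (α β : Root) : form α.1 β.1 ≤ 2 := by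
  have := root_ge α (-β)
  have h : (-β).1 = -β.1 := rfl
  rw [h, form_neg_right] at this; omega

lemma root_eq_neg {α β : Root} (h : form α.1 β.1 = -2) : β = -α := by
  have : form (α.1 + β.1) (α.1 + β.1) = 0 := by rw [form_sum, α.2, β.2, h]; rfl
  exact Subtype.ext (neg_eq_of_add_eq_zero_right (form_eq_zero this)).symm

lemma root_eq {α β : Root} (h : form α.1 β.1 = 2) : β = α := by
  have : form α.1 (-β).1 = -2 := by
    have h' : (-β).1 = -β.1 := rfl
    rw [h', form_neg_right, h]
  rw [← neg_neg_root α, ← root_eq_neg this, neg_neg_root]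

lemma lie_zero_aux (x : LieE6) : ⁅x, (0 : LieE6)⁆ = 0 := by
  have := lie_smul_aux 0 x 0
  rwa [zero_smul, zero_smul] at this

lemma trip_neg {α β γ : Root} (h : γ = -β) : ⁅rootVec α.1, ⁅rootVec β.1, rootVec γ.1⁆⁆ =
    ((form α.1 β.1 : ℤ) : ℂ) • rootVec α.1 := by
  have h1 : γ.1 = -β.1 := by rw [h]; rfl
  rw [lie_EE, h1, if_pos (add_neg_cancel _), eps_neg_right, eps_self β.2, lie_smul_aux, lie_EH,
    form_cast]
  simp

lemma trip_one {α β γ : Root} (h : form β.1 γ.1 = -1) :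
    ⁅rootVec α.1, ⁅rootVec β.1, rootVec γ.1⁆⁆ =
    (eps β.1 γ.1 * (eps α.1 β.1 * eps α.1 γ.1)) • (if α.1 + β.1 + γ.1 = 0 then
      cartan (fun i => (α.1 i : ℂ)) else rootVec (α.1 + β.1 + γ.1)) := by
  have hr : form (β.1 + γ.1) (β.1 + γ.1) = 2 := by rw [form_sum, β.2, γ.2, h]; rfl
  have h0 : β.1 + γ.1 ≠ 0 := fun e => by rw [e] at hr; simp [form] at hr
  rw [lie_EE, if_neg h0, lie_smul_aux]
  have := lie_EE α ⟨_, hr⟩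
  simp only at this
  rw [this, ← eps_add_right, smul_smul, add_assoc]

lemma trip_zero {α β γ : Root} (h : 0 ≤ form β.1 γ.1) :
    ⁅rootVec α.1, ⁅rootVec β.1, rootVec γ.1⁆⁆ = 0 := by
  have hr : form (β.1 + γ.1) (β.1 + γ.1) = 4 + 2 * form β.1 γ.1 := by
    rw [form_sum, β.2, γ.2]; rfl
  have h0 : β.1 + γ.1 ≠ 0 := fun e => by
    rw [e] at hr
    have : form (0 : Fin 6 → ℤ) 0 = 0 := by simp [form]
    omega
  have h2 : form (β.1 + γ.1) (β.1 + γ.1) ≠ 2 := by rw [hr]; omega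
  rw [lie_EE, if_neg h0, rootVec_of_ne h2, smul_zero, lie_zero_aux]

lemma eps_cases (α β : Fin 6 → ℤ) : eps α β = 1 ∨ eps α β = -1 :=
  mul_self_eq_one_iff.1 (eps_mul_self α β)

lemma jac_neg (α β γ : Root) (h : γ = -β) :
    ⁅rootVec α.1, ⁅rootVec β.1, rootVec γ.1⁆⁆ + ⁅rootVec β.1, ⁅rootVec γ.1, rootVec α.1⁆⁆ +
      ⁅rootVec γ.1, ⁅rootVec α.1, rootVec β.1⁆⁆ = 0 := by
  have hg : γ.1 = -β.1 := by rw [h]; rfl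
  have h1 := root_ge α β
  have h2 := root_le α β
  have hga : form γ.1 α.1 = -form α.1 β.1 := by rw [hg, form_neg_left, form_comm]
  have hm1 : (-1 : ℂ) ^ (-1 : ℤ) = -1 := by norm_num
  rw [trip_neg h]
  obtain hp | hp | hp | hp | hp : form α.1 β.1 = -2 ∨ form α.1 β.1 = -1 ∨ form α.1 β.1 = 0 ∨
    form α.1 β.1 = 1 ∨ form α.1 β.1 = 2 := by omega
  · have e := root_eq_neg hp
    have e2 : γ = α := by rw [h, e, neg_neg_root]
    rw [trip_zero (α := β) (by omega), trip_neg e, hga, hp, e2]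
    simp
  · rw [trip_zero (α := β) (by omega), trip_one hp, hp, hg, eps_neg_left, eps_neg_left,
      eps_self β.2, eps_swap α.1 β.1, hp, hm1]
    have e : -β.1 + α.1 + β.1 = α.1 := by abel
    have e0 : α.1 ≠ 0 := fun e => by have := α.2; rw [e] at this; simp [form] at this
    rw [e, if_neg e0]
    obtain e1 | e1 := eps_cases α.1 β.1 <;> rw [e1] <;> simp
  · rw [trip_zero (α := β) (by omega), trip_zero (α := γ) (by omega), hp]
    simp
  · rw [trip_zero (α := γ) (by omega), trip_one (α := β) (β := γ) (by omega), hp, hg,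
      eps_neg_left, eps_neg_right, eps_self β.2]
    have e : β.1 + -β.1 + α.1 = α.1 := by abel
    have e0 : α.1 ≠ 0 := fun e => by have := α.2; rw [e] at this; simp [form] at this
    rw [e, if_neg e0]
    obtain e1 | e1 := eps_cases β.1 α.1 <;> rw [e1] <;> simp
  · have e := root_eq hp
    have e2 : α = -γ := by rw [h, neg_neg_root, e]
    have hbg : form β.1 γ.1 = -2 := by rw [hg, form_neg_right, β.2]
    rw [trip_zero (α := γ) (by omega), trip_neg e2, hbg, hp, e]
    simp

lemma jac_two (α β γ : Root) (hp : form α.1 β.1 = 0) (hq : form β.1 γ.1 = -1)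
    (hr : form γ.1 α.1 = -1) :
    ⁅rootVec α.1, ⁅rootVec β.1, rootVec γ.1⁆⁆ + ⁅rootVec β.1, ⁅rootVec γ.1, rootVec α.1⁆⁆ +
      ⁅rootVec γ.1, ⁅rootVec α.1, rootVec β.1⁆⁆ = 0 := by
  have hm1 : (-1 : ℂ) ^ (-1 : ℤ) = -1 := by norm_num
  have hn : form (α.1 + β.1 + γ.1) (α.1 + β.1 + γ.1) = 2 := by
    rw [form_sum, form_sum, form_add_left, α.2, β.2, γ.2, form_comm α.1 γ.1, hp, hq, hr]; rfl
  have h0 : α.1 + β.1 + γ.1 ≠ 0 := fun e => by rw [e] at hn; simp [form] at hn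
  have hc : β.1 + γ.1 + α.1 = α.1 + β.1 + γ.1 := by abel
  rw [trip_zero (α := γ) hp.ge, trip_one hq, trip_one hr, hc, if_neg h0, if_neg h0, eps_swap α.1 β.1, hp,
    eps_swap γ.1 α.1, hr, hm1, add_zero, ← add_smul]
  convert zero_smul ℂ _
  rw [zpow_zero]; ring

lemma jac_EEE (α β γ : Root) :
    ⁅rootVec α.1, ⁅rootVec β.1, rootVec γ.1⁆⁆ + ⁅rootVec β.1, ⁅rootVec γ.1, rootVec α.1⁆⁆ +
      ⁅rootVec γ.1, ⁅rootVec α.1, rootVec β.1⁆⁆ = 0 := by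
  have hp1 := root_ge α β
  have hp2 := root_le α β
  have hq1 := root_ge β γ
  have hq2 := root_le β γ
  have hr1 := root_ge γ α
  have hr2 := root_le γ α
  have hn : form (α.1 + β.1 + γ.1) (α.1 + β.1 + γ.1) =
      6 + 2 * (form α.1 β.1 + form β.1 γ.1 + form γ.1 α.1) := by
    rw [form_sum, form_sum, form_add_left, α.2, β.2, γ.2, form_comm α.1 γ.1]; ring
  have hn0 := form_nonneg (α.1 + β.1 + γ.1)
  by_cases hq : form β.1 γ.1 = -2
  · exact jac_neg α β γ (root_eq_neg hq)
  by_cases hr : form γ.1 α.1 = -2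
  · have := jac_neg β γ α (root_eq_neg hr)
    rw [add_comm, ← add_assoc] at this; exact this
  by_cases hp : form α.1 β.1 = -2
  · have := jac_neg γ α β (root_eq_neg hp)
    rw [add_assoc, add_comm] at this; exact this
  set s := form α.1 β.1 + form β.1 γ.1 + form γ.1 α.1 with hs
  have hm1 : (-1 : ℂ) ^ (-1 : ℤ) = -1 := by norm_num
  have hc1 : β.1 + γ.1 + α.1 = α.1 + β.1 + γ.1 := by abel
  have hc2 : γ.1 + α.1 + β.1 = α.1 + β.1 + γ.1 := by abel
  obtain h3 | h2 | h1 : s = -3 ∨ s = -2 ∨ -1 ≤ s := by omega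
  · have e1 : form α.1 β.1 = -1 := by omega
    have e2 : form β.1 γ.1 = -1 := by omega
    have e3 : form γ.1 α.1 = -1 := by omega
    have h0 : α.1 + β.1 + γ.1 = 0 := form_eq_zero (by rw [hn, h3]; rfl)
    rw [trip_one e1, trip_one e2, trip_one e3, hc1, hc2, if_pos h0, if_pos h0, if_pos h0,
      eps_swap α.1 β.1, e1, eps_swap β.1 γ.1, e2, eps_swap γ.1 α.1, e3, hm1]
    have hg : ∀ i, (γ.1 i : ℂ) = -α.1 i - β.1 i := fun i => by
      have := congrFun h0 i
      have : α.1 i + β.1 i + γ.1 i = 0 := this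
      have : ((α.1 i + β.1 i + γ.1 i : ℤ) : ℂ) = 0 := by rw [this]; simp
      push_cast at this; linear_combination this
    rw [← map_smul, ← map_smul, ← map_smul, ← map_add, ← map_add]
    convert map_zero cartan
    funext i
    simp only [Pi.add_apply, Pi.smul_apply, smul_eq_mul, hg, Pi.zero_apply]
    ring
  · obtain ⟨a, b, c⟩ | ⟨a, b, c⟩ | ⟨a, b, c⟩ :
        (form α.1 β.1 = 0 ∧ form β.1 γ.1 = -1 ∧ form γ.1 α.1 = -1) ∨
        (form α.1 β.1 = -1 ∧ form β.1 γ.1 = 0 ∧ form γ.1 α.1 = -1) ∨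
        (form α.1 β.1 = -1 ∧ form β.1 γ.1 = -1 ∧ form γ.1 α.1 = 0) := by omega
    · exact jac_two α β γ a b c
    · have := jac_two β γ α b c a
      rw [add_comm, ← add_assoc] at this; exact this
    · have := jac_two γ α β c a b
      rw [add_assoc, add_comm] at this; exact this
  · have key : ∀ δ ε ζ : Root, δ.1 + ε.1 + ζ.1 = α.1 + β.1 + γ.1 → form ε.1 ζ.1 ≠ -2 →
        -2 ≤ form ε.1 ζ.1 → ⁅rootVec δ.1, ⁅rootVec ε.1, rootVec ζ.1⁆⁆ = 0 := by
      intro δ ε ζ hsum hne hge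
      obtain h | h : form ε.1 ζ.1 = -1 ∨ 0 ≤ form ε.1 ζ.1 := by omega
      · have h0 : α.1 + β.1 + γ.1 ≠ 0 := fun e => by rw [e] at hn; simp [form] at hn; omega
        rw [trip_one h, hsum, if_neg h0, rootVec_of_ne (by omega), smul_zero]
      · exact trip_zero h
    rw [key α β γ rfl hq hq1, key β γ α hc1 hr hr1, key γ α β hc2 hp hp1]; simp

lemma lie_ind {p : LieE6 → Prop} (hadd : ∀ x y, p x → p y → p (x + y))
    (hsmul : ∀ (c : ℂ) x, p x → p (c • x)) (hH : ∀ h, p (cartan h))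
    (hE : ∀ α : Root, p (rootVec α.1)) (x : LieE6) : p x := by
  have hx : x = cartan x.1 + ∑ α : Root, x.2 α • rootVec α.1 := by
    let f : LieE6 →ₗ[ℂ] (Fin 6 → ℂ) := ⟨⟨fun x => x.1, fun _ _ => rfl⟩, fun _ _ => rfl⟩
    let g : LieE6 →ₗ[ℂ] (Root → ℂ) := ⟨⟨fun x => x.2, fun _ _ => rfl⟩, fun _ _ => rfl⟩
    refine LieE6.ext ?_ (funext fun γ => ?_)
    · have : (∑ α : Root, x.2 α • rootVec α.1).1 = 0 := by
        change f _ = 0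
        rw [map_sum]
        exact Finset.sum_eq_zero fun α _ => by rw [map_smul]; exact smul_zero _
      rw [fst_add, this, fst_cartan, add_zero]
    · have : (∑ α : Root, x.2 α • rootVec α.1).2 γ = x.2 γ := by
        change g _ γ = _
        rw [map_sum, Finset.sum_apply, Finset.sum_eq_single γ]
        · rw [map_smul]; change x.2 γ * (rootVec γ.1).2 γ = _
          rw [snd_rootVec', if_pos rfl, mul_one]
        · intro b _ hb
          rw [map_smul]; change x.2 b * (rootVec b.1).2 γ = _
          rw [snd_rootVec', if_neg hb.symm, mul_zero]
        · simp
      rw [snd_add, Pi.add_apply, this, snd_cartan, Pi.zero_apply, zero_add]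
  rw [hx]
  refine hadd _ _ (hH _) (Finset.sum_induction _ p hadd ?_ fun α _ => hsmul _ _ (hE α))
  simpa using hH 0

/-- The cyclic sum in the Jacobi identity. -/
noncomputable def jac (x y z : LieE6) : LieE6 := ⁅x, ⁅y, z⁆⁆ + ⁅y, ⁅z, x⁆⁆ + ⁅z, ⁅x, y⁆⁆

lemma jac_rot {x y z : LieE6} (h : jac x y z = 0) : jac y z x = 0 := by
  rw [← h, jac, jac]; abel

lemma jac_add (x x' y z : LieE6) : jac (x + x') y z = jac x y z + jac x' y z := by
  rw [jac, jac, jac, add_lie_aux, lie_add_aux z, lie_add_aux y, add_lie_aux, lie_add_aux z]; abel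

lemma jac_smul (c : ℂ) (x y z : LieE6) : jac (c • x) y z = c • jac x y z := by
  rw [jac, jac, smul_lie_aux, lie_smul_aux c z, lie_smul_aux c y, smul_lie_aux, lie_smul_aux c z,
    smul_add, smul_add]

lemma jac_ind {y z : LieE6} (hH : ∀ h, jac (cartan h) y z = 0)
    (hE : ∀ α : Root, jac (rootVec α.1) y z = 0) (x : LieE6) : jac x y z = 0 := by
  refine lie_ind (p := fun x => jac x y z = 0) ?_ ?_ hH hE x
  · intro x x' h h'; rw [jac_add, h, h', add_zero]
  · intro c x h; rw [jac_smul, h, smul_zero]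

lemma jac_HHE (h h' : Fin 6 → ℂ) (α : Root) : jac (cartan h) (cartan h') (rootVec α.1) = 0 := by
  rw [jac, lie_HH, lie_zero_aux, lie_HE, lie_EH, ← neg_smul, lie_smul_aux, lie_smul_aux, lie_HE,
    lie_HE, smul_smul, smul_smul, add_zero, ← add_smul]
  refine (congrArg (· • rootVec α.1) ?_).trans (zero_smul ℂ _)
  ring

lemma jac_HEE (h : Fin 6 → ℂ) (α β : Root) : jac (cartan h) (rootVec α.1) (rootVec β.1) = 0 := by
  have hadd := rootEval_add α.1 β.1 h
  rw [jac, lie_EH, lie_HE, ← neg_smul, lie_smul_aux, lie_smul_aux, lie_skew_aux (rootVec α.1)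
    (rootVec β.1), smul_neg, ← neg_smul, add_assoc, ← add_smul, lie_EE]
  split_ifs with h0
  · have : rootEval (α.1 + β.1) h = 0 := by rw [h0]; simp [rootEval, form]
    rw [lie_smul_aux, lie_HH, smul_zero, zero_add, ← neg_add, add_comm (rootEval β.1 h), ← hadd,
      this, neg_zero, zero_smul]
  · rw [lie_smul_aux, lie_HE, smul_smul, smul_smul, hadd, ← add_smul]
    refine (congrArg (· • rootVec (α.1 + β.1)) ?_).trans (zero_smul ℂ _)
    ring

lemma jacobi_aux (x y z : LieE6) : jac x y z = 0 := by
  refine jac_ind (fun h1 => ?_) (fun α => ?_) x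
  · refine jac_rot (jac_rot (jac_ind (fun h2 => ?_) (fun β => ?_) y))
    · have := jac_ind (y := cartan h1) (z := cartan h2) (fun h3 => ?_) (fun γ => ?_) z
      · exact jac_rot (jac_rot this)
      · simp only [jac, lie_HH, lie_zero_aux, add_zero]
      · exact jac_rot (jac_rot (jac_HHE _ _ _))
    · have := jac_ind (y := cartan h1) (z := rootVec β.1) (fun h3 => ?_) (fun γ => ?_) z
      · exact jac_rot (jac_rot this)
      · exact jac_HHE _ _ _
      · exact jac_rot (jac_rot (jac_HEE _ _ _))
  · refine jac_rot (jac_rot (jac_ind (fun h2 => ?_) (fun β => ?_) y))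
    · have := jac_ind (y := rootVec α.1) (z := cartan h2) (fun h3 => ?_) (fun γ => ?_) z
      · exact jac_rot (jac_rot this)
      · exact jac_rot (jac_HHE h2 h3 α)
      · exact jac_rot (jac_HEE _ _ _)
    · have := jac_ind (y := rootVec α.1) (z := rootVec β.1) (fun h3 => ?_) (fun γ => ?_) z
      · exact jac_rot (jac_rot this)
      · exact jac_HEE _ _ _
      · exact jac_EEE _ _ _

noncomputable instance : LieRing LieE6 where
  add_lie := add_lie_aux
  lie_add := lie_add_aux
  lie_self x := by
    have h : (2 : ℂ) • ⁅x, x⁆ = 0 := by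
      nth_rewrite 1 [two_smul, lie_skew_aux x x]
      exact neg_add_cancel _
    exact (smul_eq_zero.1 h).resolve_left two_ne_zero
  leibniz_lie x y z := by
    have h : ⁅x, ⁅y, z⁆⁆ + ⁅y, ⁅z, x⁆⁆ + ⁅z, ⁅x, y⁆⁆ = 0 := jacobi_aux x y z
    rw [lie_skew_aux x z, lie_skew_aux ⁅x, y⁆ z, ← neg_one_smul ℂ ⁅x, z⁆, lie_smul_aux,
      neg_one_smul] at h
    rw [← sub_eq_zero, ← h]; abel

noncomputable instance : LieAlgebra ℂ LieE6 where
  lie_smul := lie_smul_aux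

lemma tauRoot_tauRoot (α : Root) : tauRoot (tauRoot α) = α := by
  refine Subtype.ext (funext fun i => ?_)
  simp [tauRoot, tau_tau]

/-- `tauRoot` as a permutation of the roots. -/
def tauEquiv : Root ≃ Root := ⟨tauRoot, tauRoot, tauRoot_tauRoot, tauRoot_tauRoot⟩

/-- The sign `(-1) ^ α₂`, where `α₂` is the coefficient of the simple root `β₂` in `α`. -/
noncomputable def sgn (α : Root) : ℂ := (-1) ^ α.1 1

lemma sgn_tau (α : Root) : sgn (tauRoot α) = sgn α := rfl

lemma sgn_mul_neg (α : Root) : sgn α * sgn (-α) = 1 := by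
  rw [sgn, sgn, ← zpow_add₀ (by norm_num)]
  have : (-α).1 = -α.1 := rfl
  rw [this]; simp

lemma sgn_add {α β γ : Root} (h : α.1 + β.1 = γ.1) : sgn γ = sgn α * sgn β := by
  rw [sgn, sgn, sgn, ← zpow_add₀ (by norm_num), ← h]; rfl

lemma eps_tauRoot (α β : Root) : eps (tauRoot α).1 (tauRoot β).1 = eps α.1 β.1 :=
  eps_tau α.1 β.1

lemma rootEval_tauRoot (γ : Root) (h : Fin 6 → ℂ) :
    rootEval (tauRoot γ).1 h = rootEval γ.1 (fun i => h (tau i)) := by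
  rw [rootEval_apply, rootEval_apply, ← form_tau]
  simp [tauRoot, tau_tau]

/-- The linear map underlying the Cartan involution of `EI`. -/
noncomputable def thetaLin : LieE6 →ₗ[ℂ] LieE6 where
  toFun x := ⟨fun i => x.1 (tau i), fun γ => sgn γ * x.2 (tauRoot γ)⟩
  map_add' _ _ := LieE6.ext rfl (funext fun _ => mul_add _ _ _)
  map_smul' _ _ := LieE6.ext rfl (funext fun _ => mul_left_comm _ _ _)

lemma fst_thetaLin (x : LieE6) : (thetaLin x).1 = fun i => x.1 (tau i) := rfl
lemma snd_thetaLin (x : LieE6) (γ : Root) :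
    (thetaLin x).2 γ = sgn γ * x.2 (tauRoot γ) := rfl

lemma thetaLin_lie (x y : LieE6) : thetaLin ⁅x, y⁆ = ⁅thetaLin x, thetaLin y⁆ := by
  refine LieE6.ext (funext fun i => ?_) (funext fun γ => ?_)
  · rw [fst_thetaLin, fst_lie, fst_lie]
    simp only [Finset.sum_apply]
    refine Fintype.sum_equiv tauEquiv _ _ fun α => ?_
    have h1 : tauEquiv α = tauRoot α := rfl
    have h2 : (tauRoot α).1 i = α.1 (tau i) := rfl
    have h3 : -tauRoot α = tauRoot (-α) := rfl
    have h4 : -(tauRoot α).1 = (tauRoot (-α)).1 := rfl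
    have h5 : -α.1 = (-α).1 := rfl
    rw [h1, snd_thetaLin, h3, snd_thetaLin, h4, eps_tauRoot, tauRoot_tauRoot, tauRoot_tauRoot,
      Pi.smul_apply, Pi.smul_apply, sgn_tau, sgn_tau, h2, h5, smul_eq_mul, smul_eq_mul]
    linear_combination (-(x.2 α * y.2 (-α) * eps α.1 (-α).1 * α.1 (tau i))) * sgn_mul_neg α
  · have hs : sgn γ * (∑ α : Root, ∑ β : Root,
         if α.1 + β.1 = (tauRoot γ).1 then eps α.1 β.1 * (x.2 α * y.2 β) else 0) =
        ∑ α : Root, ∑ β : Root, if α.1 + β.1 = γ.1 then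
          eps α.1 β.1 * ((thetaLin x).2 α * (thetaLin y).2 β) else 0 := by
      rw [Finset.mul_sum]
      refine Fintype.sum_equiv tauEquiv _ _ fun α => ?_
      rw [Finset.mul_sum]
      refine Fintype.sum_equiv tauEquiv _ _ fun β => ?_
      have h1 : ∀ α, tauEquiv α = tauRoot α := fun _ => rfl
      rw [h1, h1, eps_tauRoot, snd_thetaLin, snd_thetaLin, tauRoot_tauRoot, tauRoot_tauRoot,
        sgn_tau, sgn_tau]
      have hiff : (tauRoot α).1 + (tauRoot β).1 = γ.1 ↔ α.1 + β.1 = (tauRoot γ).1 := by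
        constructor
        · intro h; funext i
          have := congrFun h (tau i)
          simpa [tauRoot, tau_tau] using this
        · intro h; funext i
          have := congrFun h (tau i)
          simpa [tauRoot, tau_tau] using this
      by_cases h : α.1 + β.1 = (tauRoot γ).1
      · have := sgn_add h
        rw [sgn_tau] at this
        rw [if_pos h, if_pos (hiff.2 h), this]; ring
      · rw [if_neg h, if_neg (fun h' => h (hiff.1 h')), mul_zero]
    rw [snd_thetaLin, snd_lie, snd_lie, mul_add, hs, fst_thetaLin, fst_thetaLin, snd_thetaLin,
      snd_thetaLin, rootEval_tauRoot, rootEval_tauRoot]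
    ring

/-- The (complexified) Cartan involution of `EI = E_{6(6)}`, given by its Vogan diagram: the
Dynkin diagram automorphism `tau` with the node `β₂` painted. It maps `β_i^∨` to
`β_{tau i}^∨`, and the simple root vector `e_{β_i}` to `e_{β_{tau i}}` for `i ≠ 2`, and `e_{β₂}`
to `-e_{β₂}`. -/
noncomputable def theta : LieE6 →ₗ⁅ℂ⁆ LieE6 :=
  { thetaLin with map_lie' := fun {x y} => thetaLin_lie x y }

lemma theta_theta (x : LieE6) : theta (theta x) = x := by
  have h : ∀ γ, sgn γ * sgn γ = 1 := fun γ => by rw [sgn, ← mul_zpow]; simp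
  refine LieE6.ext (funext fun i => ?_) (funext fun γ => ?_)
  · change x.1 (tau (tau i)) = _; rw [tau_tau]
  · change sgn γ * (sgn (tauRoot γ) * x.2 (tauRoot (tauRoot γ))) = _
    rw [tauRoot_tauRoot, sgn_tau, ← mul_assoc, h, one_mul]

/-- `𝔨`, the `+1` eigenspace of the Cartan involution. -/
noncomputable def kk : Submodule ℂ LieE6 := Module.End.eigenspace (theta : LieE6 →ₗ[ℂ] LieE6) 1

/-- `𝔭`, the `-1` eigenspace of the Cartan involution. -/
noncomputable def pp : Submodule ℂ LieE6 := Module.End.eigenspace (theta : LieE6 →ₗ[ℂ] LieE6) (-1)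

/-- The fundamental Cartan subalgebra `𝔥_f = 𝔱_f ⊕ 𝔞_f`. -/
noncomputable def hf : Submodule ℂ LieE6 := LinearMap.range cartan

/-- `𝔱_f = 𝔥_f ∩ 𝔨`. -/
noncomputable def tf : Submodule ℂ LieE6 := hf ⊓ kk

/-- `𝔞_f = 𝔥_f ∩ 𝔭`. -/
noncomputable def af : Submodule ℂ LieE6 := hf ⊓ pp

/-- The real span of the roots in `𝔥_f^*`; a vector `μ` stands for `∑ i, μ i • β i`. All weights
occurring below lie in it. -/
abbrev Wt : Type := Fin 6 → ℝ

/-- The value of the weight `μ` at `t ∈ 𝔥_f`. -/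
noncomputable def ev (μ : Wt) (t : LieE6) : ℂ := form (fun i => (μ i : ℂ)) t.1

/-- The real weights of `𝔱_f`, embedded in those of `𝔥_f` as the functionals that vanish
on `𝔞_f`. -/
def tfDual : Set Wt := {μ | ∀ t ∈ af, ev μ t = 0}

/-- The root system `Δ(𝔤, 𝔥_f)`. -/
def rootsH : Set Wt := {α | α ≠ 0 ∧ ∃ x : LieE6, x ≠ 0 ∧ ∀ t ∈ hf, ⁅t, x⁆ = ev α t • x}

/-- The nonzero weights of `𝔱_f` in a subspace `S` of `𝔤`. For `S = ⊤, 𝔨, 𝔭` these are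
`Δ(𝔤, 𝔱_f)`, `Δ(𝔨, 𝔱_f)` and `Δ(𝔭, 𝔱_f)`. -/
def rootsT (S : Submodule ℂ LieE6) : Set Wt :=
  {μ | μ ∈ tfDual ∧ μ ≠ 0 ∧ ∃ x ∈ S, x ≠ 0 ∧ ∀ t ∈ tf, ⁅t, x⁆ = ev μ t • x}

/-- `Δ⁺(𝔨, 𝔱_f)`: the compact roots that are nonnegative combinations of the simple roots `β i`
(equivalently, of their restrictions to `𝔱_f`, the simple roots of `Δ⁺(𝔤, 𝔱_f)`). -/
def posK : Set Wt := {γ | γ ∈ rootsT kk ∧ ∀ i, 0 ≤ γ i}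

/-- `P` is a positive system of the root system `Φ`: the roots that are positive on some regular
element. -/
def IsPositiveSystem (Φ P : Set Wt) : Prop :=
  ∃ x : Wt, (∀ α ∈ Φ, form x α ≠ 0) ∧ P = {α | α ∈ Φ ∧ 0 < form x α}

/-- `μ` is dominant with respect to the set `P` of positive roots. -/
def IsDominant (P : Set Wt) (μ : Wt) : Prop := ∀ α ∈ P, 0 ≤ form μ α

/-- Half the sum of the elements of `P`. -/
noncomputable def halfSum (P : Set Wt) : Wt := (1 / 2 : ℝ) • ∑ᶠ α ∈ P, α

/-- `ρ_c`. -/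
noncomputable def rhoC : Wt := halfSum posK

/-- `⟨μ, γ^∨⟩ = 2 (μ, γ) / (γ, γ)`. -/
noncomputable def pairing (μ γ : Wt) : ℝ := 2 * form μ γ / form γ γ

/-- The reflection `s_γ`. -/
noncomputable def refl (γ : Wt) : Module.End ℝ Wt where
  toFun μ := μ - pairing μ γ • γ
  map_add' μ ν := by simp only [pairing, form_add_left, mul_add, add_div, add_smul]; abel
  map_smul' c μ := by
    simp only [pairing, form_smul_left, RingHom.id_apply, smul_sub, smul_smul]
    congr 2; ring

/-- The Weyl group `W(𝔨, 𝔱_f)`: the monoid generated by the reflections in compact roots, which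
is a group because reflections are involutions. -/
noncomputable def weylK : Submonoid (Module.End ℝ Wt) :=
  Submonoid.closure (refl '' rootsT kk)

/-- The norm induced from the invariant form `B`. As `𝔤` is simple, `B` is unique up to
scaling; the scalar is `κ > 0`. -/
noncomputable def wtNorm (κ : ℝ) (μ : Wt) : ℝ := √(κ * form μ μ)

/-- `y` is the projection of `v` to the dominant Weyl chamber of the positive system `P`, that is,
the point of this closed convex cone that is nearest to `v`. -/
def IsChamberProj (P : Set Wt) (v y : Wt) : Prop :=
  IsDominant P y ∧ ∀ z, IsDominant P z → form (v - y) (v - y) ≤ form (v - z) (v - z)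

/-- The lambda norm of the `𝔨`-type with highest weight `μ`: the norm of `λ_a(μ)`, the projection
of `μ + 2ρ_c - ρ'` to the dominant chamber of a positive system `P` of `Δ(𝔤, 𝔥_f)` that makes
`μ + 2ρ_c` dominant, where `ρ'` is half the sum of `P`. All such `P` give the same number, so the
infimum is over a one-element set. -/
noncomputable def lambdaNorm (κ : ℝ) (μ : Wt) : ℝ :=
  sInf {r | ∃ P y, IsPositiveSystem rootsH P ∧ IsDominant P (μ + (2 : ℝ) • rhoC) ∧
    IsChamberProj P (μ + (2 : ℝ) • rhoC - halfSum P) y ∧ r = wtNorm κ y}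

/-- The spin norm of the `𝔨`-type with highest weight `μ`: the minimum of `‖{μ - ρ_n^(j)} + ρ_c‖`,
where `ρ_n^(j)` runs over the half sums of the noncompact roots in the positive systems `P` of
`Δ(𝔤, 𝔱_f)` containing `Δ⁺(𝔨, 𝔱_f)`, and `{ν}` is the dominant weight in the
`W(𝔨, 𝔱_f)`-orbit of `ν`. The infimum is over a finite nonempty set. -/
noncomputable def spinNorm (κ : ℝ) (μ : Wt) : ℝ :=
  sInf {r | ∃ P, IsPositiveSystem (rootsT ⊤) P ∧ posK ⊆ P ∧ ∃ w ∈ weylK,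
    IsDominant posK (w (μ - halfSum (P ∩ rootsT pp))) ∧
    r = wtNorm κ (w (μ - halfSum (P ∩ rootsT pp)) + rhoC)}

/-- The highest weights of the `K`-types. The group `G` is connected and centreless, hence a group
of automorphisms of its Lie algebra, and so the characters of the maximal torus `T_f` of the
connected group `K` form the lattice spanned by the weights of `𝔱_f` in `𝔤`; a `K`-type is
identified with its highest weight, a dominant character. -/
def IsKType (μ : Wt) : Prop := μ ∈ AddSubgroup.closure (rootsT ⊤) ∧ IsDominant posK μ

/-- The simple roots of `Δ⁺(𝔤, 𝔱_f)`, of type `F₄`: `α₁ = (β₁ + β₆) / 2`, `α₂ = (β₃ + β₅) / 2`,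
`α₃ = β₄`, `α₄ = β₂`. -/
noncomputable def simpleF : Fin 4 → Wt :=
  ![![1 / 2, 0, 0, 0, 0, 1 / 2], ![0, 0, 1 / 2, 0, 1 / 2, 0], ![0, 0, 0, 1, 0, 0],
    ![0, 1, 0, 0, 0, 0]]

/-- The simple roots of `Δ⁺(𝔨, 𝔱_f)`, of type `C₄`: `γ₁ = α₂ + α₃ + α₄`, `γ₂ = α₁`, `γ₃ = α₂`,
`γ₄ = α₃`. -/
noncomputable def simpleK : Fin 4 → Wt :=
  ![simpleF 1 + simpleF 2 + simpleF 3, simpleF 0, simpleF 1, simpleF 2]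

/-- The fundamental weights `ϖ₁, …, ϖ₄` of `Δ⁺(𝔨, 𝔱_f)`. -/
noncomputable def fundK : Fin 4 → Wt :=
  ![simpleK 0 + simpleK 1 + simpleK 2 + (1 / 2 : ℝ) • simpleK 3,
    simpleK 0 + (2 : ℝ) • simpleK 1 + (2 : ℝ) • simpleK 2 + simpleK 3,
    simpleK 0 + (2 : ℝ) • simpleK 1 + (3 : ℝ) • simpleK 2 + (3 / 2 : ℝ) • simpleK 3,
    simpleK 0 + (2 : ℝ) • simpleK 1 + (3 : ℝ) • simpleK 2 + (2 : ℝ) • simpleK 3]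

lemma pairing_fundK_simpleK (i j : Fin 4) :
    pairing (fundK i) (simpleK j) = if i = j then 1 else 0 := by
  fin_cases i <;> fin_cases j <;>
    simp [pairing, form, CartanMatrix.E₆, Fin.sum_univ_six, fundK, simpleK, simpleF] <;> norm_num

/-- The weight `[a, b, c, d] = a ϖ₁ + b ϖ₂ + c ϖ₃ + d ϖ₄`. -/
noncomputable def weight (a b c d : ℤ) : Wt :=
  (a : ℝ) • fundK 0 + (b : ℝ) • fundK 1 + (c : ℝ) • fundK 2 + (d : ℝ) • fundK 3

end EI

/-! Restriction to `𝔱_f` is written in coordinates `Fin 4 → ℤ` in which `Δ(𝔤, 𝔱_f)` is the set of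
integral vectors of square length 2 or 4. The short ones come from pairs of roots swapped by `θ`, so
they are weights of both `𝔨` and `𝔭`. The long ones come from `θ`-fixed roots and are compact
exactly when their coordinates are even (`rootsT_kk`, `rootsT_pp`). Hence `𝔨` has the standard `C₄`
with `ρ_c = (4, 3, 2, 1)`. A positive system of `F₄` containing `Δ⁺(𝔨, 𝔱_f)` is fixed by the signs
of `x₀ - x₁ - x₂ ∓ x₃`, which leaves three, indexed by `j`. Their `E₆` half sums `ρ'_j = ρ_c +
ρ_n^(j)` all have the same length.

Let `j` be such that `μ + 2ρ_c` is dominant for the system `j`, and let `i` be arbitrary. Then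
`‖λ_a(μ)‖ ≤ ‖μ + 2ρ_c - ρ'_j‖ ≤ ‖μ + 2ρ_c - ρ'_i‖ = ‖(μ - ρ_n^(i)) + ρ_c‖ ≤ ‖{μ - ρ_n^(i)} + ρ_c‖`.
The first step holds because projection to a cone does not increase the norm, the second because
`ρ'_j` pairs best with a `j`-dominant vector, the last because the dominant vector of a Weyl orbit
pairs best with `ρ_c`. If the two norms agree, then for `i` attaining the spin norm every step is an
equality. So `μ + 2ρ_c - ρ'_j` is its own projection, hence `j`-dominant; then `μ + 2ρ_c` is
strictly `j`-dominant, which forces `i = j`; and `μ - ρ_n^(j)` is `𝔨`-dominant. Conversely these two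
dominance conditions give equality. This is `spinNorm_eq_lambdaNorm_iff`; for `[p, q, r, s]` it is a
system of linear inequalities (`exists_dominance_iff`), and `j = 1, 0, 2` yield the three families
in the order of the theorem.

Two points replace general theory. The sum `absSum` of absolute pairings with compact roots is Weyl
invariant and detects dominance, so the norm of `{ν} + ρ_c` is known without uniqueness of `{ν}`.
And `eq_posE` shows that the admissible positive systems of `E₆` are among the three: since `μ +
2ρ_c` is strictly `𝔨`-dominant, any root orthogonal to it is `θ`-fixed up to sign of the root
vector, so it is seen on `𝔱_f`. -/

namespace EI

/-! ### The bilinear form on real vectors -/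

lemma form_expand {R : Type*} [CommRing R] (x y : Fin 6 → R) : form x y =
    2 * (x 0 * y 0 + x 1 * y 1 + x 2 * y 2 + x 3 * y 3 + x 4 * y 4 + x 5 * y 5)
     - x 0 * y 2 - x 2 * y 0 - x 2 * y 3 - x 3 * y 2 - x 3 * y 4 - x 4 * y 3
     - x 4 * y 5 - x 5 * y 4 - x 1 * y 3 - x 3 * y 1 := by
  simp [form, CartanMatrix.E₆, Fin.sum_univ_six]; ring

lemma form_sub_left {R : Type*} [CommRing R] (x y z : Fin 6 → R) :
    form (x - y) z = form x z - form y z := by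
  rw [sub_eq_add_neg, form_add_left, form_neg_left, sub_eq_add_neg]

lemma form_sub_right {R : Type*} [CommRing R] (x y z : Fin 6 → R) :
    form x (y - z) = form x y - form x z := by
  rw [sub_eq_add_neg, form_add_right, form_neg_right, sub_eq_add_neg]

lemma form_ofReal (x y : Wt) :
    form (fun i => (x i : ℂ)) (fun i => (y i : ℂ)) = (form x y : ℝ) := by
  simp only [form_expand]; push_cast; ring

lemma form_intCast (x y : Fin 6 → ℤ) :
    form (fun i => (x i : ℝ)) (fun i => (y i : ℝ)) = (form x y : ℤ) := by
  simp only [form_expand]; push_cast; ring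

lemma real_form_sos (x : Wt) : 30 * form x x =
    15 * (2 * x 0 - x 2) ^ 2 + 15 * (2 * x 1 - x 3) ^ 2 + 15 * (2 * x 5 - x 4) ^ 2 +
    5 * (3 * x 2 - 2 * x 3) ^ 2 + 5 * (3 * x 4 - 2 * x 3) ^ 2 + 5 * (x 3) ^ 2 := by
  rw [form_expand]; ring

lemma real_form_nonneg (x : Wt) : 0 ≤ form x x := by
  have h : 0 ≤ 30 * form x x := by rw [real_form_sos]; positivity
  linarith

lemma real_form_eq_zero {x : Wt} (h : form x x = 0) : x = 0 := by
  have e := real_form_sos x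
  rw [h] at e
  have h0 := sq_nonneg (2 * x 0 - x 2)
  have h1 := sq_nonneg (2 * x 1 - x 3)
  have h2 := sq_nonneg (2 * x 5 - x 4)
  have h3 := sq_nonneg (3 * x 2 - 2 * x 3)
  have h4 := sq_nonneg (3 * x 4 - 2 * x 3)
  have h5 := sq_nonneg (x 3)
  have z0 : 2 * x 0 - x 2 = 0 := pow_eq_zero_iff two_ne_zero |>.1 (by linarith)
  have z1 : 2 * x 1 - x 3 = 0 := pow_eq_zero_iff two_ne_zero |>.1 (by linarith)
  have z2 : 2 * x 5 - x 4 = 0 := pow_eq_zero_iff two_ne_zero |>.1 (by linarith)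
  have z3 : 3 * x 2 - 2 * x 3 = 0 := pow_eq_zero_iff two_ne_zero |>.1 (by linarith)
  have z4 : 3 * x 4 - 2 * x 3 = 0 := pow_eq_zero_iff two_ne_zero |>.1 (by linarith)
  have z5 : x 3 = 0 := pow_eq_zero_iff two_ne_zero |>.1 (by linarith)
  funext i
  fin_cases i <;> simp <;> linarith

/-! ### Coordinates on the weights of `𝔱_f` -/

/-- Coordinates in which the restricted root system is the standard one of type `F₄`,
containing the standard `C₄`. -/
def coord {R : Type*} [CommRing R] (x : Fin 6 → R) : Fin 4 → R :=
  ![x 1, x 0 + x 5 - x 1, x 2 + x 4 - x 1 - x 0 - x 5, 2 * x 3 - x 2 - x 4 - x 1]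

/-- The weight of `𝔱_f` with the given coordinates. -/
noncomputable def emb : (Fin 4 → ℝ) →ₗ[ℝ] Wt where
  toFun v := ![(v 0 + v 1) / 2, v 0, (2 * v 0 + v 1 + v 2) / 2,
    (3 * v 0 + v 1 + v 2 + v 3) / 2, (2 * v 0 + v 1 + v 2) / 2, (v 0 + v 1) / 2]
  map_add' u v := by funext i; fin_cases i <;> simp <;> ring
  map_smul' c v := by funext i; fin_cases i <;> simp <;> ring

lemma emb_apply (v : Fin 4 → ℝ) : emb v = ![(v 0 + v 1) / 2, v 0, (2 * v 0 + v 1 + v 2) / 2,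
    (3 * v 0 + v 1 + v 2 + v 3) / 2, (2 * v 0 + v 1 + v 2) / 2, (v 0 + v 1) / 2] := rfl

/-- The componentwise inclusion of integral vectors in real ones. -/
def intCast {ι : Type*} (v : ι → ℤ) : ι → ℝ := fun i => (v i : ℝ)

@[simp] lemma intCast_apply {ι : Type*} (v : ι → ℤ) (i : ι) : intCast v i = (v i : ℝ) := rfl

lemma intCast_injective {ι : Type*} : Function.Injective (intCast (ι := ι)) := fun _ _ h =>
  funext fun i => Int.cast_injective (congrFun h i)

lemma dot_four {R : Type*} [CommRing R] (u v : Fin 4 → R) :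
    u ⬝ᵥ v = u 0 * v 0 + u 1 * v 1 + u 2 * v 2 + u 3 * v 3 := by
  simp [dotProduct, Fin.sum_univ_four]

lemma dot_intCast (u v : Fin 4 → ℤ) : intCast u ⬝ᵥ intCast v = ((u ⬝ᵥ v : ℤ) : ℝ) := by
  simp only [dot_four, intCast_apply]; push_cast; rfl

lemma coord_intCast (x : Fin 6 → ℤ) : coord (intCast x) = intCast (coord x) := by
  funext i; fin_cases i <;> simp [coord]

lemma coord_emb (v : Fin 4 → ℝ) : coord (emb v) = v := by
  funext i; fin_cases i <;> simp [coord, emb_apply] <;> ring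

lemma emb_injective : Function.Injective emb := Function.LeftInverse.injective coord_emb

lemma form_emb_right (x : Wt) (v : Fin 4 → ℝ) : form x (emb v) = coord x ⬝ᵥ v / 2 := by
  simp only [form_expand, dot_four]; simp [coord, emb_apply]; ring

lemma form_emb_left (v : Fin 4 → ℝ) (x : Wt) : form (emb v) x = v ⬝ᵥ coord x / 2 := by
  rw [form_comm, form_emb_right, dotProduct_comm]

lemma form_emb_emb (u v : Fin 4 → ℝ) : form (emb u) (emb v) = u ⬝ᵥ v / 2 := by
  rw [form_emb_right, coord_emb]

/-- `emb ∘ coord` is averaging over the diagram automorphism, that is, restriction to `𝔱_f` followed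
by extension by zero on `𝔞_f`. -/
lemma emb_coord_apply (x : Wt) (i : Fin 6) : emb (coord x) i = (x i + x (tau i)) / 2 := by
  fin_cases i <;> simp [emb_apply, coord, tau] <;> ring

lemma emb_comp_tau (v : Fin 4 → ℝ) (i : Fin 6) : emb v (tau i) = emb v i := by
  fin_cases i <;> simp [emb_apply, tau]

/-! ### Weight vectors -/

lemma lie_cartan (h : Fin 6 → ℂ) (x : LieE6) :
    ⁅cartan h, x⁆ = ⟨0, fun γ => rootEval γ.1 h * x.2 γ⟩ := by
  refine LieE6.ext ?_ (funext fun γ => ?_)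
  · rw [fst_lie]; simp
  · rw [snd_lie]; simp

lemma lie_cartan_eq_iff (h : Fin 6 → ℂ) (x : LieE6) (c : ℂ) :
    ⁅cartan h, x⁆ = c • x ↔ c • x.1 = 0 ∧ ∀ γ, rootEval γ.1 h * x.2 γ = c * x.2 γ := by
  rw [lie_cartan, LieE6.ext_iff]
  exact and_congr eq_comm funext_iff

lemma exists_coeff_ne_zero {x : LieE6} (hx : x ≠ 0) : x.1 ≠ 0 ∨ ∃ γ, x.2 γ ≠ 0 := by
  by_contra! h
  exact hx (LieE6.ext h.1 (funext h.2))

lemma cartan_mem_hf (h : Fin 6 → ℂ) : cartan h ∈ hf := ⟨h, rfl⟩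

lemma mem_kk {x : LieE6} : x ∈ kk ↔ theta x = x := by
  rw [kk, Module.End.mem_eigenspace_iff, one_smul]; rfl

lemma mem_pp {x : LieE6} : x ∈ pp ↔ theta x = -x := by
  rw [pp, Module.End.mem_eigenspace_iff, neg_one_smul]; rfl

lemma theta_cartan (h : Fin 6 → ℂ) : theta (cartan h) = cartan (fun i => h (tau i)) :=
  LieE6.ext rfl (funext fun _ => mul_zero _)

lemma snd_theta (x : LieE6) (γ : Root) : (theta x).2 γ = sgn γ * x.2 (tauRoot γ) := rfl

lemma cartan_mem_tf {h : Fin 6 → ℂ} (hh : ∀ i, h (tau i) = h i) : cartan h ∈ tf := by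
  refine ⟨cartan_mem_hf h, mem_kk.2 ?_⟩
  rw [theta_cartan]; congr 1; funext i; exact hh i

lemma cartan_mem_af {h : Fin 6 → ℂ} (hh : ∀ i, h (tau i) = -h i) : cartan h ∈ af := by
  refine ⟨cartan_mem_hf h, mem_pp.2 ?_⟩
  rw [theta_cartan, ← map_neg]; congr 1; funext i; exact hh i

lemma mem_tf {t : LieE6} (ht : t ∈ tf) : ∃ h, t = cartan h ∧ ∀ i, h (tau i) = h i := by
  obtain ⟨⟨h, rfl⟩, hk⟩ := ht
  refine ⟨h, rfl, fun i => ?_⟩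
  have := mem_kk.1 hk
  rw [theta_cartan] at this
  exact congrFun (congrArg LieE6.fst this) i

lemma mem_af {t : LieE6} (ht : t ∈ af) : ∃ h, t = cartan h ∧ ∀ i, h (tau i) = -h i := by
  obtain ⟨⟨h, rfl⟩, hk⟩ := ht
  refine ⟨h, rfl, fun i => ?_⟩
  have := mem_pp.1 hk
  rw [theta_cartan] at this
  exact congrFun (congrArg LieE6.fst this) i

lemma mem_tfDual {μ : Wt} : μ ∈ tfDual ↔ emb (coord μ) = μ := by
  constructor
  · intro h
    -- The vector `μ - τμ` itself defines an element of `𝔞_f`; pairing it with `μ` gives half of its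
    -- own square length.
    have h1 := h (cartan fun i => ((μ i - μ (tau i) : ℝ) : ℂ))
      (cartan_mem_af fun i => by rw [tau_tau]; push_cast; ring)
    rw [ev, fst_cartan, form_ofReal, Complex.ofReal_eq_zero] at h1
    have h2 : form (fun i => μ i - μ (tau i)) (fun i => μ i - μ (tau i)) = 0 := by
      have e : (fun i => μ i - μ (tau i)) = μ - fun i => μ (tau i) := rfl
      rw [e] at h1 ⊢
      have := form_tau μ μ
      rw [form_sub_right] at h1
      rw [form_sub_right, form_sub_left, form_sub_left, form_comm (fun i => μ (tau i)) μ]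
      linarith
    have h3 := real_form_eq_zero h2
    funext i
    have := congrFun h3 i
    simp only [Pi.zero_apply] at this
    rw [emb_coord_apply]; linarith
  · intro h t ht
    obtain ⟨y, rfl, hy⟩ := mem_af ht
    have e := form_tau (fun i => (μ i : ℂ)) y
    have hμ : ∀ i, μ (tau i) = μ i := fun i => by rw [← h, emb_comp_tau]
    have e2 : (fun i => y (tau i)) = -y := funext hy
    simp only [hμ, e2, form_neg_right] at e
    rw [ev, fst_cartan]
    linear_combination (-1 / 2 : ℂ) * e

lemma mem_rootsH {μ : Wt} : μ ∈ rootsH ↔ ∃ α : Root, μ = intCast α.1 := by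
  constructor
  · rintro ⟨h0, x, hx, hw⟩
    have hw' := fun h => (lie_cartan_eq_iff h x _).1 (hw _ (cartan_mem_hf h))
    -- A nonzero Cartan component makes the weight vanish on all of `𝔥_f`, and evaluating at the
    -- element with coordinates `μ` gives `(μ, μ) = 0`. A nonzero component along `γ` makes `γ` and
    -- `μ` agree, which is tested at `γ - μ`.
    rcases exists_coeff_ne_zero hx with h1 | ⟨γ, hγ⟩
    · have h2 := (smul_eq_zero.1 (hw' fun i => (μ i : ℂ)).1).resolve_right h1
      rw [ev, fst_cartan, form_ofReal, Complex.ofReal_eq_zero] at h2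
      exact absurd (real_form_eq_zero h2) h0
    · refine ⟨γ, ?_⟩
      have h2 := mul_right_cancel₀ hγ ((hw' fun i => ((intCast γ.1 - μ) i : ℂ)).2 γ)
      have e : (fun i => (γ.1 i : ℂ)) = fun i => (intCast γ.1 i : ℂ) := by simp
      rw [ev, fst_cartan, form_ofReal, rootEval_apply, e, form_ofReal, Complex.ofReal_inj] at h2
      have h3 : form (intCast γ.1 - μ) (intCast γ.1 - μ) = 0 := by
        rw [form_sub_left, h2, sub_self]
      exact (sub_eq_zero.1 (real_form_eq_zero h3)).symm
  · rintro ⟨α, rfl⟩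
    refine ⟨fun h => ?_, rootVec α.1, fun h => ?_, ?_⟩
    · have e : ((form α.1 α.1 : ℤ) : ℝ) = form (intCast α.1) (intCast α.1) := (form_intCast _ _).symm
      rw [h, α.2] at e
      simp [form] at e
    · have := congrFun (congrArg LieE6.snd h) α
      classical
      rw [snd_rootVec', if_pos rfl] at this
      exact one_ne_zero this
    · rintro _ ⟨h, rfl⟩
      rw [lie_cartan_eq_iff]
      refine ⟨by simp, fun γ => ?_⟩
      classical
      rw [snd_rootVec']
      split_ifs with hγ
      · subst hγ; simp [ev, rootEval_apply]
      · simp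

/-- A weight vector for a weight in `Δ(𝔤, 𝔱_f)` has a nonzero component along a root that
restricts to this weight. -/
lemma exists_root_of_weight {μ : Wt} {x : LieE6} (hμ : μ ∈ tfDual) (h0 : μ ≠ 0) (hx : x ≠ 0)
    (hw : ∀ t ∈ tf, ⁅t, x⁆ = ev μ t • x) :
    ∃ γ : Root, x.2 γ ≠ 0 ∧ μ = emb (intCast (coord γ.1)) := by
  have hw' := fun (v : Fin 4 → ℝ) => (lie_cartan_eq_iff (fun i => (emb v i : ℂ)) x _).1
    (hw _ (cartan_mem_tf fun i => by rw [emb_comp_tau]))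
  simp only [ev, fst_cartan, form_ofReal] at hw'
  rcases exists_coeff_ne_zero hx with h1 | ⟨γ, hγ⟩
  · have h2 := (smul_eq_zero.1 (hw' (coord μ)).1).resolve_right h1
    rw [mem_tfDual.1 hμ, Complex.ofReal_eq_zero] at h2
    exact absurd (real_form_eq_zero h2) h0
  · refine ⟨γ, hγ, ?_⟩
    -- Only elements of `𝔱_f` may be tested, so the difference is taken after restriction.
    set u := coord (intCast γ.1) - coord μ with hu
    have h2 := mul_right_cancel₀ hγ ((hw' u).2 γ)
    have e : (fun i => (γ.1 i : ℂ)) = fun i => (intCast γ.1 i : ℂ) := by simp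
    rw [rootEval_apply, e, form_ofReal, Complex.ofReal_inj, form_emb_right, form_emb_right] at h2
    have h3 : form (emb u) (emb u) = 0 := by
      rw [form_emb_emb]; nth_rewrite 1 [hu]; rw [sub_dotProduct]; linarith
    have h4 := real_form_eq_zero h3
    rw [hu, map_sub, mem_tfDual.1 hμ, sub_eq_zero] at h4
    rw [← h4, coord_intCast]

/-- Elements of `𝔱_f` are fixed by `τ`, so `γ` and `τγ` take the same value on them; a combination
of their two root vectors is therefore a weight vector. -/
lemma root_vector_weight (γ : Root) {t : LieE6} (ht : t ∈ tf) {x : LieE6} (h1 : x.1 = 0)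
    (h2 : ∀ δ, x.2 δ ≠ 0 → δ = γ ∨ δ = tauRoot γ) :
    ⁅t, x⁆ = ev (emb (intCast (coord γ.1))) t • x := by
  obtain ⟨h, rfl, hh⟩ := mem_tf ht
  rw [lie_cartan_eq_iff]
  refine ⟨by rw [h1, smul_zero], fun δ => ?_⟩
  by_cases hδ : x.2 δ = 0
  · simp [hδ]
  congr 1
  have key : rootEval γ.1 h = ev (emb (intCast (coord γ.1))) (cartan h) := by
    have a0 : h 5 = h 0 := hh 0
    have a1 : h 4 = h 2 := hh 2
    rw [ev, fst_cartan, rootEval_apply, form_expand, form_expand, a0, a1]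
    simp [emb_apply, coord]
    ring
  rcases h2 δ hδ with rfl | rfl
  · exact key
  · rw [rootEval_tauRoot, ← key]; congr 1; funext i; exact hh i

/-! ### The root systems of types `F₄`, `C₄` and `E₆` in coordinates -/

/-- The roots of type `F₄` in coordinates (long roots have square length `4`). -/
noncomputable def rootsF : Finset (Fin 4 → ℤ) :=
  (Fintype.piFinset fun _ => Finset.Icc (-2) 2).filter fun v => v ⬝ᵥ v = 2 ∨ v ⬝ᵥ v = 4

/-- The coordinates of the elements of `Δ(𝔨, 𝔱_f)`. -/
noncomputable def rootsCompact : Finset (Fin 4 → ℤ) :=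
  rootsF.filter fun v => v ⬝ᵥ v = 2 ∨ v 0 % 2 = 0

/-- The coordinates of the elements of `Δ(𝔭, 𝔱_f)`. -/
noncomputable def rootsNoncompact : Finset (Fin 4 → ℤ) :=
  rootsF.filter fun v => v ⬝ᵥ v = 2 ∨ v 0 % 2 = 1

/-- The vector of the root lattice of `E₆` whose restriction to `𝔱_f` has coordinates `v`, and
which pairs with `𝔞_f` according to `d` and `e`; it is meaningful if the parities fit. -/
def lift (v : Fin 4 → ℤ) (d e : ℤ) : Fin 6 → ℤ :=
  ![(v 0 + v 1 + d) / 2, v 0, (2 * v 0 + v 1 + v 2 + e) / 2, (3 * v 0 + v 1 + v 2 + v 3) / 2,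
    (2 * v 0 + v 1 + v 2 - e) / 2, (v 0 + v 1 - d) / 2]

/-- The parameters for which `lift` gives a root of `E₆`. -/
noncomputable def rootsE : Finset ((Fin 4 → ℤ) × ℤ × ℤ) :=
  (rootsF ×ˢ (Finset.Icc (-1) 1 ×ˢ Finset.Icc (-1) 1)).filter fun p =>
    coord (lift p.1 p.2.1 p.2.2) = p.1 ∧
      p.1 ⬝ᵥ p.1 + 2 * (p.2.1 * p.2.1 - p.2.1 * p.2.2 + p.2.2 * p.2.2) = 4

attribute [irreducible] rootsF rootsE

/-- The coordinates of `ρ_c`. -/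
def rhoK : Fin 4 → ℤ := ![4, 3, 2, 1]

/-- The coordinates of the `ρ_n^(j)`. -/
def rhoN : Fin 3 → Fin 4 → ℤ := ![![7, 2, 1, 0], ![6, 3, 2, 1], ![5, 4, 3, 0]]

/-- The coordinates of the half sums of the three positive systems of `Δ(𝔤, 𝔥_f)` that are
compatible with `Δ⁺(𝔨, 𝔱_f)`. -/
def rhoF : Fin 3 → Fin 4 → ℤ := ![![11, 5, 3, 1], ![10, 6, 4, 2], ![9, 7, 5, 1]]

/-- The simple roots of the three positive systems of type `F₄` containing `Δ⁺(𝔨, 𝔱_f)`. -/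
def simpleRoot : Fin 3 → Fin 4 → Fin 4 → ℤ :=
  ![![![0, 1, -1, 0], ![0, 0, 1, -1], ![0, 0, 0, 2], ![1, -1, -1, -1]],
    ![![-1, 1, 1, 1], ![1, -1, -1, 1], ![0, 1, -1, 0], ![0, 0, 1, -1]],
    ![![-1, 1, 1, -1], ![1, -1, 0, 0], ![0, 1, -1, 0], ![0, 0, 0, 2]]]

/-- Twice the fundamental coweights dual to `simpleRoot`. -/
def coweight : Fin 3 → Fin 4 → Fin 4 → ℤ :=
  ![![![2, 2, 0, 0], ![4, 2, 2, 0], ![3, 1, 1, 1], ![2, 0, 0, 0]],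
    ![![1, 1, 1, 1], ![3, 1, 1, 1], ![2, 2, 0, 0], ![4, 2, 2, 0]],
    ![![2, 2, 2, 0], ![4, 2, 2, 0], ![2, 2, 0, 0], ![1, 1, 1, 1]]]

lemma rhoK_add_rhoN (j : Fin 3) : rhoK + rhoN j = rhoF j := by revert j; decide

lemma sum_rootsNoncompact : ∀ j, ∑ v ∈ rootsNoncompact with 0 < rhoF j ⬝ᵥ v, v = 2 • rhoN j := by
  decide +kernel

lemma sum_rootsCompact : ∑ v ∈ rootsCompact with 0 < rhoK ⬝ᵥ v, v = 2 • rhoK := by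
  decide +kernel

/-- The right side is twice the embedded vector `rhoF j`, written without denominators. In
particular the half sum is `τ`-invariant. -/
lemma sum_rootsE : ∀ j, ∑ p ∈ rootsE with 0 < rhoF j ⬝ᵥ p.1, lift p.1 p.2.1 p.2.2 =
    ![rhoF j 0 + rhoF j 1, 2 * rhoF j 0, 2 * rhoF j 0 + rhoF j 1 + rhoF j 2,
      3 * rhoF j 0 + rhoF j 1 + rhoF j 2 + rhoF j 3, 2 * rhoF j 0 + rhoF j 1 + rhoF j 2,
      rhoF j 0 + rhoF j 1] := by
  decide +kernel

/-- By `sum_coweight`, `coweight j i ⬝ᵥ v` is twice the coefficient of `v` at the `i`-th simple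
root, so this is what makes `simpleRoot j` a base. -/
lemma coweight_sign : ∀ j, ∀ v ∈ rootsF,
    (∀ i, 0 ≤ coweight j i ⬝ᵥ v) ∨ (∀ i, coweight j i ⬝ᵥ v ≤ 0) := by
  decide +kernel

lemma coweight_sum_ne_zero : ∀ j, ∀ v ∈ rootsF, ∃ i, coweight j i ⬝ᵥ v ≠ 0 := by
  decide +kernel

/-- A long `v` needs `d = e = 0`; a short one needs `d² - de + e² = 1`, with the parities of `d` and
`e` dictated by `v`. -/
lemma exists_lift : ∀ v ∈ rootsF, ∃ d ∈ Finset.Icc (-1) 1, ∃ e ∈ Finset.Icc (-1) 1,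
    coord (lift v d e) = v ∧ v ⬝ᵥ v + 2 * (d * d - d * e + e * e) = 4 := by
  decide +kernel

/-- The four expressions are, up to a factor 2, the coefficients of the weight in the simple roots
`β i`; this turns the definition of `posK` into positivity on `ρ_c`. -/
lemma posK_coeff : ∀ v ∈ rootsCompact,
    ((0 ≤ v 0 + v 1 ∧ 0 ≤ v 0 ∧ 0 ≤ 2 * v 0 + v 1 + v 2 ∧ 0 ≤ 3 * v 0 + v 1 + v 2 + v 3) ↔
      0 < rhoK ⬝ᵥ v) := by
  decide +kernel

/-- The partial sums are the pairings with the fundamental weights of `C₄`, hence nonnegative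
multiples of the simple-root coefficients of a positive root. -/
lemma compact_sign : ∀ v ∈ rootsCompact,
    (0 < rhoK ⬝ᵥ v ∧ 0 ≤ v 0 ∧ 0 ≤ v 0 + v 1 ∧ 0 ≤ v 0 + v 1 + v 2 ∧
      0 ≤ v 0 + v 1 + v 2 + v 3) ∨
    (rhoK ⬝ᵥ v < 0 ∧ v 0 ≤ 0 ∧ v 0 + v 1 ≤ 0 ∧ v 0 + v 1 + v 2 ≤ 0 ∧
      v 0 + v 1 + v 2 + v 3 ≤ 0) := by
  decide +kernel

lemma simpleRoot_mem : ∀ j i, simpleRoot j i ∈ rootsF := by decide +kernel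

lemma rhoF_dot_pos : ∀ j, ∀ v ∈ rootsCompact, 0 < rhoK ⬝ᵥ v → 0 < rhoF j ⬝ᵥ v := by
  decide +kernel

lemma simpleCompact_mem : ∀ v ∈ [![1, -1, 0, 0], ![0, 1, -1, 0], ![0, 0, 1, -1], ![0, 0, 0, 2]],
    v ∈ rootsCompact ∧ 0 < rhoK ⬝ᵥ v := by
  decide +kernel

lemma rhoF_dot_simpleRoot : ∀ j i, 0 < rhoF j ⬝ᵥ simpleRoot j i := by decide

lemma sum_coweight (j : Fin 3) (z : Fin 4 → ℝ) (v : Fin 4 → ℤ) :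
    2 * (z ⬝ᵥ intCast v) =
      ∑ i, (coweight j i ⬝ᵥ v : ℤ) * (z ⬝ᵥ intCast (simpleRoot j i)) := by
  fin_cases j <;>
    simp [dot_four, Fin.sum_univ_four, coweight, simpleRoot] <;> ring

/-! ### Restriction of the roots of `E₆` -/

lemma mem_rootsF {v : Fin 4 → ℤ} : v ∈ rootsF ↔ v ⬝ᵥ v = 2 ∨ v ⬝ᵥ v = 4 := by
  rw [rootsF, Finset.mem_filter, and_iff_right_iff_imp]
  intro h
  rw [Fintype.mem_piFinset]
  intro i
  rw [Finset.mem_Icc]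
  have h4 : v ⬝ᵥ v ≤ 4 := by omega
  rw [dot_four] at h4
  have b : v i ^ 2 ≤ 2 ^ 2 := by
    fin_cases i <;> simp <;>
      nlinarith [mul_self_nonneg (v 0), mul_self_nonneg (v 1), mul_self_nonneg (v 2),
        mul_self_nonneg (v 3)]
  exact abs_le.1 (abs_le_of_sq_le_sq b (by norm_num))

/-- The orthogonal splitting into the parts on `𝔱_f` and `𝔞_f`. The second part is a form of type
`A₂` in `α 0 - α 5` and `α 2 - α 4`. For a root this leaves square length 4 with zero `𝔞_f` part, or
2 with `𝔞_f` part of value 1. -/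
lemma form_eq_coord (α : Fin 6 → ℤ) : 2 * form α α = coord α ⬝ᵥ coord α +
    2 * ((α 0 - α 5) ^ 2 - (α 0 - α 5) * (α 2 - α 4) + (α 2 - α 4) ^ 2) := by
  rw [form_expand, dot_four]; simp [coord]; ring

lemma coord_dot_even (α : Fin 6 → ℤ) : 2 ∣ coord α ⬝ᵥ coord α := by
  have := form_eq_coord α
  omega

/-- An integral vector restricting to zero is a combination of `β₁ - β₆` and `β₃ - β₅`, and its
square length is divisible by 4. -/
lemma coord_ne_zero {α : Fin 6 → ℤ} (h : form α α = 2) : coord α ≠ 0 := by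
  intro h0
  have h1 : α 1 = 0 := congrFun h0 0
  have h2 : α 0 + α 5 - α 1 = 0 := congrFun h0 1
  have h3 : α 2 + α 4 - α 1 - α 0 - α 5 = 0 := congrFun h0 2
  have h4 : 2 * α 3 - α 2 - α 4 - α 1 = 0 := congrFun h0 3
  have a5 : α 5 = -α 0 := by linarith
  have a4 : α 4 = -α 2 := by linarith
  have a3 : α 3 = 0 := by linarith
  rw [form_expand, a5, a4, a3, h1] at h
  ring_nf at h
  omega

lemma coord_mem_rootsF (α : Root) : coord α.1 ∈ rootsF := by
  rw [mem_rootsF]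
  have h1 := form_eq_coord α.1
  have h2 := coord_dot_even α.1
  have h3 : 0 < coord α.1 ⬝ᵥ coord α.1 := by
    refine lt_of_le_of_ne ?_ (Ne.symm fun h => coord_ne_zero α.2 (dotProduct_self_eq_zero.1 h))
    rw [dot_four]; nlinarith [mul_self_nonneg (coord α.1 0), mul_self_nonneg (coord α.1 1),
      mul_self_nonneg (coord α.1 2), mul_self_nonneg (coord α.1 3)]
  rw [α.2] at h1
  have h4 : 0 ≤ (α.1 0 - α.1 5) ^ 2 - (α.1 0 - α.1 5) * (α.1 2 - α.1 4) +
      (α.1 2 - α.1 4) ^ 2 := by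
    nlinarith [sq_nonneg (α.1 0 - α.1 5 - (α.1 2 - α.1 4)), sq_nonneg (α.1 0 - α.1 5),
      sq_nonneg (α.1 2 - α.1 4)]
  omega

lemma eq_zero_of_sq_sub_mul {d e : ℤ} (h : d ^ 2 - d * e + e ^ 2 = 0) : d = 0 ∧ e = 0 := by
  constructor <;> nlinarith [sq_nonneg (2 * d - e), sq_nonneg (2 * e - d), sq_nonneg d,
    sq_nonneg e]

lemma tau_fixed_iff (α : Root) : tauRoot α = α ↔ coord α.1 ⬝ᵥ coord α.1 = 4 := by
  have h1 := form_eq_coord α.1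
  rw [α.2] at h1
  constructor
  · intro h
    have h5 : α.1 5 = α.1 0 := congrFun (congrArg Subtype.val h) 0
    have h4 : α.1 4 = α.1 2 := congrFun (congrArg Subtype.val h) 2
    rw [h5, h4] at h1
    linarith
  · intro h
    obtain ⟨h5, h4⟩ := eq_zero_of_sq_sub_mul (d := α.1 0 - α.1 5) (e := α.1 2 - α.1 4)
      (by linarith)
    refine Subtype.ext (funext fun i => ?_)
    fin_cases i <;> simp [tauRoot, tau] <;> linarith

lemma lift_coord (α : Fin 6 → ℤ) : lift (coord α) (α 0 - α 5) (α 2 - α 4) = α := by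
  funext i
  fin_cases i <;> simp [lift, coord] <;> omega

lemma mem_rootsE_of_root (α : Root) :
    (coord α.1, α.1 0 - α.1 5, α.1 2 - α.1 4) ∈ rootsE := by
  have h1 := form_eq_coord α.1
  have h2 := mem_rootsF.1 (coord_mem_rootsF α)
  rw [α.2] at h1
  set d := α.1 0 - α.1 5 with hd
  set e := α.1 2 - α.1 4 with he
  have h3 : d ^ 2 - d * e + e ^ 2 ≤ 1 := by omega
  rw [rootsE, Finset.mem_filter, Finset.mem_product, Finset.mem_product, Finset.mem_Icc,
    Finset.mem_Icc]
  have hL := lift_coord α.1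
  rw [← hd, ← he] at hL
  -- From `4 (d² - de + e²) = 3 d² + (2e - d)²`, the bound 1 gives `d² < 2`.
  have bd : d ^ 2 ≤ 1 ^ 2 := by
    have : d ^ 2 < 2 := by nlinarith [sq_nonneg (2 * e - d)]
    omega
  have be : e ^ 2 ≤ 1 ^ 2 := by
    have : e ^ 2 < 2 := by nlinarith [sq_nonneg (2 * d - e)]
    omega
  refine ⟨⟨coord_mem_rootsF α, abs_le.1 (abs_le_of_sq_le_sq bd (by norm_num)),
    abs_le.1 (abs_le_of_sq_le_sq be (by norm_num))⟩, ?_, ?_⟩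
  · simp only [hL]
  · linarith

lemma lift_sub {v : Fin 4 → ℤ} {d e : ℤ} (h : coord (lift v d e) = v) :
    lift v d e 0 - lift v d e 5 = d ∧ lift v d e 2 - lift v d e 4 = e := by
  have h1 := congrFun h 1
  have h2 := congrFun h 2
  simp [coord, lift] at h1 h2
  constructor <;> simp [lift] <;> omega

lemma form_lift {v : Fin 4 → ℤ} {d e : ℤ} (h : coord (lift v d e) = v)
    (h4 : v ⬝ᵥ v + 2 * (d * d - d * e + e * e) = 4) : form (lift v d e) (lift v d e) = 2 := by
  have := form_eq_coord (lift v d e)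
  rw [(lift_sub h).1, (lift_sub h).2, h] at this
  linarith

lemma lift_injOn : Set.InjOn (fun p : (Fin 4 → ℤ) × ℤ × ℤ => lift p.1 p.2.1 p.2.2) rootsE := by
  refine Set.LeftInvOn.injOn
    (f₁' := fun x : Fin 6 → ℤ => (coord x, x 0 - x 5, x 2 - x 4)) fun p hp => ?_
  rw [Finset.mem_coe, rootsE, Finset.mem_filter] at hp
  simp only [hp.2.1, (lift_sub hp.2.1).1, (lift_sub hp.2.1).2]

lemma exists_root_coord {v : Fin 4 → ℤ} (hv : v ∈ rootsF) : ∃ α : Root, coord α.1 = v := by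
  obtain ⟨d, -, e, -, h1, h2⟩ := exists_lift v hv
  exact ⟨⟨_, form_lift h1 h2⟩, h1⟩

/-! ### The root systems of `𝔱_f` -/

/-- The weight of `𝔱_f` with the given integral coordinates. -/
noncomputable def wt (v : Fin 4 → ℤ) : Wt := emb (intCast v)

lemma wt_injective : Function.Injective wt := emb_injective.comp intCast_injective

lemma coord_wt (v : Fin 4 → ℤ) : coord (wt v) = intCast v := coord_emb _

lemma intCast_add {ι : Type*} (u v : ι → ℤ) : intCast (u + v) = intCast u + intCast v := by
  funext i; simp

lemma intCast_sub {ι : Type*} (u v : ι → ℤ) : intCast (u - v) = intCast u - intCast v := by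
  funext i; simp

lemma wt_add (u v : Fin 4 → ℤ) : wt (u + v) = wt u + wt v := by
  rw [wt, intCast_add, map_add]; rfl

lemma wt_sub (u v : Fin 4 → ℤ) : wt (u - v) = wt u - wt v := by
  rw [wt, intCast_sub, map_sub]; rfl

/-- `wt` as a homomorphism of groups. -/
noncomputable def wtHom : (Fin 4 → ℤ) →+ Wt := AddMonoidHom.mk' wt wt_add

lemma wt_ne_zero {v : Fin 4 → ℤ} (hv : v ∈ rootsF) : wt v ≠ 0 := by
  intro h
  have : v = 0 := wt_injective (h.trans (map_zero wtHom).symm)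
  rw [mem_rootsF, this] at hv
  simp at hv

lemma wt_mem_tfDual (v : Fin 4 → ℤ) : wt v ∈ tfDual := by
  rw [mem_tfDual, coord_wt]; rfl

lemma theta_rootVec_snd (γ δ : Root) [Decidable (tauRoot δ = γ)] :
    (theta (rootVec γ.1)).2 δ = if tauRoot δ = γ then sgn δ else 0 := by
  rw [snd_theta]
  classical
  rw [snd_rootVec']
  split_ifs <;> simp

lemma theta_add_smul (x : LieE6) {c : ℂ} (hc : c * c = 1) :
    theta (x + c • theta x) = c • (x + c • theta x) := by
  rw [map_add, map_smul, theta_theta, smul_add, smul_smul, hc, one_smul, add_comm]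

lemma sgn_eq (α : Root) : sgn α = if α.1 1 % 2 = 0 then 1 else -1 := by
  rw [sgn]
  split_ifs with h
  · exact Even.neg_one_zpow (Int.even_iff.2 h)
  · exact Odd.neg_one_zpow (Int.odd_iff.2 (by omega))

/-- A root `γ` with `θ γ ≠ γ`, or such that `e_γ` is in the `c`-eigenspace of `θ`, restricts to
a weight of this eigenspace. -/
lemma exists_weight_vector (γ : Root) {c : ℂ} (hc : c * c = 1) (hγ : tauRoot γ = γ → sgn γ = c) :
    ∃ x : LieE6, theta x = c • x ∧ x ≠ 0 ∧ ∀ t ∈ tf, ⁅t, x⁆ = ev (wt (coord γ.1)) t • x := by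
  classical
  refine ⟨rootVec γ.1 + c • theta (rootVec γ.1), theta_add_smul _ hc, fun h => ?_, fun t ht =>
    root_vector_weight γ ht ?_ fun δ hδ => ?_⟩
  · have := congrFun (congrArg LieE6.snd h) γ
    rw [snd_add, snd_smul, Pi.add_apply, Pi.smul_apply, theta_rootVec_snd, snd_rootVec',
      if_pos rfl, snd_zero, Pi.zero_apply, smul_eq_mul] at this
    split_ifs at this with h'
    -- If `γ` is `τ`-fixed, the coefficient at `γ` is `1 + c * c = 2`; otherwise it is 1.
    · rw [hγ h', hc] at this; norm_num at this
    · simp at this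
  · rw [fst_add, fst_smul, fst_rootVec, zero_add, smul_eq_zero]; right; rfl
  · rw [snd_add, snd_smul, Pi.add_apply, Pi.smul_apply, theta_rootVec_snd, snd_rootVec'] at hδ
    by_contra! h
    rw [if_neg h.1, if_neg, smul_zero, add_zero] at hδ
    · exact hδ rfl
    · rintro rfl; exact h.2 (tauRoot_tauRoot δ).symm

lemma rootsT_kk : rootsT kk = wt '' rootsCompact := by
  ext μ
  constructor
  · rintro ⟨hμ, h0, x, hxk, hx, hw⟩
    obtain ⟨γ, hγ, rfl⟩ := exists_root_of_weight hμ h0 hx hw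
    refine ⟨_, ?_, rfl⟩
    rw [Finset.mem_coe, rootsCompact, Finset.mem_filter]
    refine ⟨coord_mem_rootsF γ, (mem_rootsF.1 (coord_mem_rootsF γ)).imp_right fun h4 => ?_⟩
    -- For a long weight the root is `τ`-fixed, so `θ` acts on its root vector by `sgn γ`. The
    -- coefficient of `β₂` that determines this sign is the coordinate `v 0`.
    have h1 := congrFun (congrArg LieE6.snd (mem_kk.1 hxk)) γ
    rw [snd_theta, (tau_fixed_iff γ).2 h4, mul_eq_right₀ hγ, sgn_eq] at h1
    by_contra h
    rw [if_neg (show ¬ γ.1 1 % 2 = 0 from h)] at h1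
    norm_num at h1
  · rintro ⟨v, hv, rfl⟩
    rw [Finset.mem_coe, rootsCompact, Finset.mem_filter] at hv
    obtain ⟨γ, rfl⟩ := exists_root_coord hv.1
    obtain ⟨x, h1, h2, h3⟩ := exists_weight_vector γ (one_mul 1) fun h => by
      rw [tau_fixed_iff] at h
      rw [sgn_eq, if_pos]
      exact hv.2.resolve_left (by omega)
    exact ⟨wt_mem_tfDual _, wt_ne_zero hv.1, x, mem_kk.2 (by rw [h1, one_smul]), h2, h3⟩

lemma rootsT_pp : rootsT pp = wt '' rootsNoncompact := by
  ext μ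
  constructor
  · rintro ⟨hμ, h0, x, hxk, hx, hw⟩
    obtain ⟨γ, hγ, rfl⟩ := exists_root_of_weight hμ h0 hx hw
    refine ⟨_, ?_, rfl⟩
    rw [Finset.mem_coe, rootsNoncompact, Finset.mem_filter]
    refine ⟨coord_mem_rootsF γ, (mem_rootsF.1 (coord_mem_rootsF γ)).imp_right fun h4 => ?_⟩
    have h1 : (theta x).2 γ = -(x.2 γ) := congrFun (congrArg LieE6.snd (mem_pp.1 hxk)) γ
    rw [snd_theta, (tau_fixed_iff γ).2 h4, sgn_eq] at h1
    by_contra h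
    rw [if_pos (show γ.1 1 % 2 = 0 by have : ¬ γ.1 1 % 2 = 1 := h; omega), one_mul,
      eq_neg_iff_add_eq_zero, ← two_mul] at h1
    exact hγ ((mul_eq_zero.1 h1).resolve_left two_ne_zero)
  · rintro ⟨v, hv, rfl⟩
    rw [Finset.mem_coe, rootsNoncompact, Finset.mem_filter] at hv
    obtain ⟨γ, rfl⟩ := exists_root_coord hv.1
    obtain ⟨x, h1, h2, h3⟩ := exists_weight_vector γ (c := -1) (by norm_num) fun h => by
      rw [tau_fixed_iff] at h
      rw [sgn_eq, if_neg]
      have : γ.1 1 % 2 = 1 := hv.2.resolve_left (by omega)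
      omega
    exact ⟨wt_mem_tfDual _, wt_ne_zero hv.1, x, mem_pp.2 (by rw [h1, neg_one_smul]), h2, h3⟩

lemma rootsT_top : rootsT ⊤ = wt '' rootsF := by
  ext μ
  constructor
  · rintro ⟨hμ, h0, x, -, hx, hw⟩
    obtain ⟨γ, hγ, rfl⟩ := exists_root_of_weight hμ h0 hx hw
    exact ⟨_, coord_mem_rootsF γ, rfl⟩
  · rintro ⟨v, hv, rfl⟩
    obtain ⟨γ, rfl⟩ := exists_root_coord hv
    have hc : sgn γ * sgn γ = 1 := by rw [sgn, ← mul_zpow]; simp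
    obtain ⟨x, -, h2, h3⟩ := exists_weight_vector γ hc fun _ => rfl
    exact ⟨wt_mem_tfDual _, wt_ne_zero hv, x, trivial, h2, h3⟩

lemma posK_eq : posK = wt '' (rootsCompact.filter fun v => 0 < rhoK ⬝ᵥ v : Finset _) := by
  have key : ∀ v ∈ rootsCompact, (∀ i, 0 ≤ wt v i) ↔ 0 < rhoK ⬝ᵥ v := by
    intro v hv
    rw [← posK_coeff v hv]
    simp only [wt, emb_apply, intCast_apply]
    constructor
    · intro h
      have h0 := h 0
      have h1 := h 1
      have h2 := h 2
      have h3 := h 3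
      simp at h0 h1 h2 h3
      refine ⟨?_, h1, ?_, ?_⟩
      · have : (0 : ℝ) ≤ v 0 + v 1 := by linarith
        exact_mod_cast this
      · have : (0 : ℝ) ≤ 2 * v 0 + v 1 + v 2 := by linarith
        exact_mod_cast this
      · have : (0 : ℝ) ≤ 3 * v 0 + v 1 + v 2 + v 3 := by linarith
        exact_mod_cast this
    · rintro ⟨h0, h1, h2, h3⟩
      have h0' : (0 : ℝ) ≤ v 0 + v 1 := by exact_mod_cast h0
      have h1' : (0 : ℝ) ≤ v 0 := by exact_mod_cast h1
      have h2' : (0 : ℝ) ≤ 2 * v 0 + v 1 + v 2 := by exact_mod_cast h2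
      have h3' : (0 : ℝ) ≤ 3 * v 0 + v 1 + v 2 + v 3 := by exact_mod_cast h3
      intro i
      fin_cases i <;> simp <;> linarith
  ext μ
  rw [posK, rootsT_kk]
  constructor
  · rintro ⟨⟨v, hv, rfl⟩, h⟩
    exact ⟨v, Finset.mem_coe.2 (Finset.mem_filter.2 ⟨hv, (key v hv).1 h⟩), rfl⟩
  · rintro ⟨v, hv, rfl⟩
    obtain ⟨h1, h2⟩ := Finset.mem_filter.1 (Finset.mem_coe.1 hv)
    exact ⟨⟨v, h1, rfl⟩, (key v h1).2 h2⟩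

lemma halfSum_wt_image (s : Finset (Fin 4 → ℤ)) {v : Fin 4 → ℤ} (h : ∑ u ∈ s, u = 2 • v) :
    halfSum (wt '' s) = wt v := by
  rw [halfSum, finsum_mem_image wt_injective.injOn, finsum_mem_coe_finset,
    show ∑ i ∈ s, wt i = wtHom (∑ i ∈ s, i) from (map_sum wtHom _ _).symm, h, map_nsmul,
    ← Nat.cast_smul_eq_nsmul ℝ, smul_smul]
  norm_num
  rfl

lemma rhoC_eq : rhoC = wt rhoK := by
  rw [rhoC, posK_eq]; exact halfSum_wt_image _ sum_rootsCompact

/-! ### Positive systems -/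

/-- Dominance with respect to the positive system of type `F₄` with number `j`, in coordinates. -/
def DomF (j : Fin 3) (u : Fin 4 → ℝ) : Prop := ∀ i, 0 ≤ u ⬝ᵥ intCast (simpleRoot j i)

/-- Dominance with respect to `Δ⁺(𝔨, 𝔱_f)`, in coordinates. -/
def DomK (u : Fin 4 → ℝ) : Prop := u 1 ≤ u 0 ∧ u 2 ≤ u 1 ∧ u 3 ≤ u 2 ∧ 0 ≤ u 3

lemma form_wt_right (x : Wt) (v : Fin 4 → ℤ) : form x (wt v) = coord x ⬝ᵥ intCast v / 2 :=
  form_emb_right x _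

lemma form_emb_root (u : Fin 4 → ℝ) (α : Fin 6 → ℤ) :
    form (emb u) (intCast α) = u ⬝ᵥ intCast (coord α) / 2 := by
  rw [form_emb_left, coord_intCast]

lemma form_wt_root (u : Fin 4 → ℤ) (α : Fin 6 → ℤ) :
    form (wt u) (intCast α) = (u ⬝ᵥ coord α : ℤ) / 2 := by
  rw [wt, form_emb_root, dot_intCast]

lemma dot_nonneg_of_coweight {j : Fin 3} {z : Fin 4 → ℝ} (hz : DomF j z) {v : Fin 4 → ℤ}
    (hv : ∀ i, 0 ≤ coweight j i ⬝ᵥ v) : 0 ≤ z ⬝ᵥ intCast v := by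
  have h := sum_coweight j z v
  have : 0 ≤ ∑ i, (coweight j i ⬝ᵥ v : ℤ) * (z ⬝ᵥ intCast (simpleRoot j i)) :=
    Finset.sum_nonneg fun i _ => mul_nonneg (Int.cast_nonneg (hv i)) (hz i)
  linarith

lemma dot_pos_of_coweight {j : Fin 3} {z : Fin 4 → ℝ}
    (hz : ∀ i, 0 < z ⬝ᵥ intCast (simpleRoot j i)) {v : Fin 4 → ℤ} (h0 : v ∈ rootsF)
    (hv : ∀ i, 0 ≤ coweight j i ⬝ᵥ v) : 0 < z ⬝ᵥ intCast v := by
  have h := sum_coweight j z v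
  obtain ⟨i, hi⟩ := coweight_sum_ne_zero j v h0
  have : 0 < ∑ i, (coweight j i ⬝ᵥ v : ℤ) * (z ⬝ᵥ intCast (simpleRoot j i)) :=
    Finset.sum_pos' (fun i _ => mul_nonneg (Int.cast_nonneg (hv i)) (hz i).le)
      ⟨i, Finset.mem_univ i, mul_pos (Int.cast_pos.2 (lt_of_le_of_ne (hv i) hi.symm)) (hz i)⟩
  linarith

lemma neg_mem_rootsF {v : Fin 4 → ℤ} (hv : v ∈ rootsF) : -v ∈ rootsF := by
  rw [mem_rootsF] at hv ⊢
  simpa using hv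

lemma dot_neg_of_coweight {j : Fin 3} {z : Fin 4 → ℝ}
    (hz : ∀ i, 0 < z ⬝ᵥ intCast (simpleRoot j i)) {v : Fin 4 → ℤ} (h0 : v ∈ rootsF)
    (hv : ∀ i, coweight j i ⬝ᵥ v ≤ 0) : z ⬝ᵥ intCast v < 0 := by
  have h := dot_pos_of_coweight hz (neg_mem_rootsF h0) (fun i => by simpa using hv i)
  have e : intCast (-v) = -intCast v := by funext i; simp
  rw [e, dotProduct_neg] at h
  linarith

lemma dot_pos_iff_coweight {j : Fin 3} {z : Fin 4 → ℝ}
    (hz : ∀ i, 0 < z ⬝ᵥ intCast (simpleRoot j i)) {v : Fin 4 → ℤ} (h0 : v ∈ rootsF) :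
    0 < z ⬝ᵥ intCast v ↔ ∀ i, 0 ≤ coweight j i ⬝ᵥ v := by
  refine ⟨fun h => ?_, dot_pos_of_coweight hz h0⟩
  exact (coweight_sign j v h0).resolve_right fun h' => (dot_neg_of_coweight hz h0 h').not_gt h

lemma rhoF_strict (j : Fin 3) (i : Fin 4) :
    0 < intCast (rhoF j) ⬝ᵥ intCast (simpleRoot j i) := by
  rw [dot_intCast]; exact_mod_cast rhoF_dot_simpleRoot j i

lemma rhoF_dot_pos_iff {j : Fin 3} {v : Fin 4 → ℤ} (h0 : v ∈ rootsF) :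
    0 < rhoF j ⬝ᵥ v ↔ ∀ i, 0 ≤ coweight j i ⬝ᵥ v := by
  rw [← dot_pos_iff_coweight (rhoF_strict j) h0, dot_intCast, Int.cast_pos]

lemma dot_ne_zero {j : Fin 3} {z : Fin 4 → ℝ}
    (hz : ∀ i, 0 < z ⬝ᵥ intCast (simpleRoot j i)) {v : Fin 4 → ℤ} (h0 : v ∈ rootsF) :
    z ⬝ᵥ intCast v ≠ 0 := by
  rcases coweight_sign j v h0 with h | h
  · exact (dot_pos_of_coweight hz h0 h).ne'
  · exact (dot_neg_of_coweight hz h0 h).ne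

/-- Summation by parts: the pairing is a combination of the successive differences of `u`, with the
partial sums of `v` as coefficients. -/
lemma domK_dot_nonneg {u : Fin 4 → ℝ} (hu : DomK u) {v : Fin 4 → ℤ} (hv : v ∈ rootsCompact)
    (hp : 0 < rhoK ⬝ᵥ v) : 0 ≤ u ⬝ᵥ intCast v := by
  obtain ⟨h1, h2, h3, h4⟩ := hu
  rcases compact_sign v hv with ⟨-, c0, c1, c2, c3⟩ | ⟨h, -⟩
  swap; · omega
  have c0' : (0 : ℝ) ≤ v 0 := by exact_mod_cast c0
  have c1' : (0 : ℝ) ≤ v 0 + v 1 := by exact_mod_cast c1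
  have c2' : (0 : ℝ) ≤ v 0 + v 1 + v 2 := by exact_mod_cast c2
  have c3' : (0 : ℝ) ≤ v 0 + v 1 + v 2 + v 3 := by exact_mod_cast c3
  have e : u ⬝ᵥ intCast v = (u 0 - u 1) * v 0 + (u 1 - u 2) * (v 0 + v 1) +
      (u 2 - u 3) * (v 0 + v 1 + v 2) + u 3 * (v 0 + v 1 + v 2 + v 3) := by
    simp only [dot_four, intCast_apply]; ring
  have := mul_nonneg (sub_nonneg.2 h1) c0'
  have := mul_nonneg (sub_nonneg.2 h2) c1'
  have := mul_nonneg (sub_nonneg.2 h3) c2'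
  have := mul_nonneg h4 c3'
  linarith

lemma domK_of_dot {u : Fin 4 → ℝ}
    (h : ∀ v ∈ rootsCompact, 0 < rhoK ⬝ᵥ v → 0 ≤ u ⬝ᵥ intCast v) : DomK u := by
  have key := fun v hv => h v (simpleCompact_mem v hv).1 (simpleCompact_mem v hv).2
  simp [dot_four] at key
  obtain ⟨h0, h1, h2, h3⟩ := key
  refine ⟨?_, ?_, ?_, ?_⟩ <;> linarith

lemma mem_posK {μ : Wt} : μ ∈ posK ↔ ∃ v ∈ rootsCompact, 0 < rhoK ⬝ᵥ v ∧ wt v = μ := by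
  rw [posK_eq]
  simp only [Set.mem_image, Finset.mem_coe, Finset.mem_filter, and_assoc]

lemma isDominant_posK {u : Fin 4 → ℝ} : IsDominant posK (emb u) ↔ DomK u := by
  constructor
  · intro h
    refine domK_of_dot fun v hv hp => ?_
    have := h _ (mem_posK.2 ⟨v, hv, hp, rfl⟩)
    rw [form_wt_right, coord_emb] at this
    linarith
  · intro h α hα
    obtain ⟨v, hv, hp, rfl⟩ := mem_posK.1 hα
    rw [form_wt_right, coord_emb]
    linarith [domK_dot_nonneg h hv hp]

/-- The positive system of `Δ(𝔤, 𝔥_f)` with number `j`. -/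
def posE (j : Fin 3) : Set Wt := {α | α ∈ rootsH ∧ 0 < form (wt (rhoF j)) α}

lemma intCast_mem_posE {j : Fin 3} {α : Root} :
    intCast α.1 ∈ posE j ↔ 0 < rhoF j ⬝ᵥ coord α.1 := by
  rw [posE, Set.mem_ofPred_eq, form_wt_root, and_iff_right (mem_rootsH.2 ⟨α, rfl⟩)]
  rw [div_pos_iff_of_pos_right two_pos, Int.cast_pos]

lemma isDominant_posE {j : Fin 3} {u : Fin 4 → ℝ} : IsDominant (posE j) (emb u) ↔ DomF j u := by
  constructor
  · intro h i
    obtain ⟨α, hα⟩ := exists_root_coord (simpleRoot_mem j i)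
    have := h _ (intCast_mem_posE.2 (hα ▸ rhoF_dot_simpleRoot j i))
    rw [form_emb_root, hα] at this
    linarith
  · intro h α hα
    obtain ⟨β, rfl⟩ := mem_rootsH.1 hα.1
    rw [form_emb_root]
    have := dot_nonneg_of_coweight h
      ((rhoF_dot_pos_iff (coord_mem_rootsF β)).1 (intCast_mem_posE.1 hα))
    linarith

lemma isPositiveSystem_posE (j : Fin 3) : IsPositiveSystem rootsH (posE j) := by
  refine ⟨wt (rhoF j), fun α hα => ?_, rfl⟩
  obtain ⟨β, rfl⟩ := mem_rootsH.1 hα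
  rw [wt, form_emb_root]
  exact div_ne_zero (dot_ne_zero (rhoF_strict j) (coord_mem_rootsF β)) two_ne_zero

lemma posE_eq_image (j : Fin 3) : posE j =
    (fun p : (Fin 4 → ℤ) × ℤ × ℤ => intCast (lift p.1 p.2.1 p.2.2)) ''
      (rootsE.filter fun p => 0 < rhoF j ⬝ᵥ p.1 : Finset _) := by
  ext α
  constructor
  · intro hα
    obtain ⟨β, rfl⟩ := mem_rootsH.1 hα.1
    refine ⟨_, Finset.mem_coe.2 (Finset.mem_filter.2 ⟨mem_rootsE_of_root β, ?_⟩),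
      congrArg intCast (lift_coord β.1)⟩
    exact intCast_mem_posE.1 hα
  · rintro ⟨p, hp, rfl⟩
    rw [Finset.mem_coe, Finset.mem_filter, rootsE, Finset.mem_filter] at hp
    refine (intCast_mem_posE (α := ⟨_, form_lift hp.1.2.1 hp.1.2.2⟩)).2 ?_
    simp only [hp.1.2.1]
    exact hp.2

/-- `intCast` as a homomorphism of groups. -/
def intCastHom (ι : Type*) : (ι → ℤ) →+ (ι → ℝ) := AddMonoidHom.mk' intCast intCast_add

lemma halfSum_posE (j : Fin 3) : halfSum (posE j) = wt (rhoF j) := by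
  have hinj : Set.InjOn (fun p : (Fin 4 → ℤ) × ℤ × ℤ => intCast (lift p.1 p.2.1 p.2.2))
      (rootsE.filter fun p => 0 < rhoF j ⬝ᵥ p.1 : Finset _) :=
    intCast_injective.comp_injOn (lift_injOn.mono (Finset.coe_subset.2 (Finset.filter_subset _ _)))
  rw [halfSum, posE_eq_image, finsum_mem_image hinj, finsum_mem_coe_finset]
  rw [show ∑ p ∈ rootsE with 0 < rhoF j ⬝ᵥ p.1, intCast (lift p.1 p.2.1 p.2.2) =
    intCastHom (Fin 6) (∑ p ∈ rootsE with 0 < rhoF j ⬝ᵥ p.1, lift p.1 p.2.1 p.2.2) from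
    (map_sum (intCastHom (Fin 6)) _ _).symm, sum_rootsE]
  funext i
  change (1 / 2 : ℝ) * ((_ : ℤ) : ℝ) = _
  fin_cases i <;> simp [wt, emb_apply] <;> ring

/-- The positive system of `Δ(𝔤, 𝔱_f)` with number `j`. -/
def posF (j : Fin 3) : Set Wt := wt '' (rootsF.filter fun v => 0 < rhoF j ⬝ᵥ v : Finset _)

lemma mem_posF {j : Fin 3} {v : Fin 4 → ℤ} : wt v ∈ posF j ↔ v ∈ rootsF ∧ 0 < rhoF j ⬝ᵥ v := by
  rw [posF, wt_injective.mem_set_image, Finset.mem_coe, Finset.mem_filter]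

/-- Any two vectors strictly positive on the base `simpleRoot j` define the same positive system,
because every root is a combination of the base with coefficients of one sign. -/
lemma posF_of_strict {j : Fin 3} {z : Wt}
    (hz : ∀ i, 0 < coord z ⬝ᵥ intCast (simpleRoot j i)) :
    {α | α ∈ rootsT ⊤ ∧ 0 < form z α} = posF j := by
  ext α
  rw [rootsT_top]
  constructor
  · rintro ⟨⟨v, hv, rfl⟩, h⟩
    rw [form_wt_right, div_pos_iff_of_pos_right two_pos, dot_pos_iff_coweight hz hv] at h
    exact mem_posF.2 ⟨hv, (rhoF_dot_pos_iff hv).2 h⟩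
  · rintro ⟨v, hv, rfl⟩
    obtain ⟨h1, h2⟩ := Finset.mem_filter.1 (Finset.mem_coe.1 hv)
    refine ⟨⟨v, h1, rfl⟩, ?_⟩
    rw [form_wt_right, div_pos_iff_of_pos_right two_pos, dot_pos_iff_coweight hz h1]
    exact (rhoF_dot_pos_iff h1).1 h2

lemma isPositiveSystem_posF (j : Fin 3) : IsPositiveSystem (rootsT ⊤) (posF j) := by
  have hz : ∀ i, 0 < coord (wt (rhoF j)) ⬝ᵥ intCast (simpleRoot j i) := by
    rw [coord_wt]; exact rhoF_strict j
  refine ⟨wt (rhoF j), fun α hα => ?_, (posF_of_strict hz).symm⟩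
  rw [rootsT_top] at hα
  obtain ⟨v, hv, rfl⟩ := hα
  rw [form_wt_right]
  exact div_ne_zero (dot_ne_zero hz hv) two_ne_zero

lemma mem_rootsF_of_compact {v : Fin 4 → ℤ} (h : v ∈ rootsCompact) : v ∈ rootsF :=
  (Finset.mem_filter.1 h).1

lemma posK_subset_posF (j : Fin 3) : posK ⊆ posF j := by
  intro α hα
  obtain ⟨v, hv, hp, rfl⟩ := mem_posK.1 hα
  exact mem_posF.2 ⟨mem_rootsF_of_compact hv, rhoF_dot_pos j v hv hp⟩

lemma halfSum_posF_inter (j : Fin 3) : halfSum (posF j ∩ rootsT pp) = wt (rhoN j) := by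
  have : posF j ∩ rootsT pp =
      wt '' (rootsNoncompact.filter fun v => 0 < rhoF j ⬝ᵥ v : Finset _) := by
    ext α
    rw [rootsT_pp]
    constructor
    · rintro ⟨h, v, hv, rfl⟩
      exact ⟨v, Finset.mem_coe.2 (Finset.mem_filter.2 ⟨hv, (mem_posF.1 h).2⟩), rfl⟩
    · rintro ⟨v, hv, rfl⟩
      obtain ⟨h1, h2⟩ := Finset.mem_filter.1 (Finset.mem_coe.1 hv)
      exact ⟨mem_posF.2 ⟨(Finset.mem_filter.1 h1).1, h2⟩, v, h1, rfl⟩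
  rw [this]
  exact halfSum_wt_image _ (sum_rootsNoncompact j)

lemma longNoncompact_mem : ![1, -1, -1, -1] ∈ rootsF ∧ ![1, -1, -1, 1] ∈ rootsF := by
  simp [mem_rootsF]

lemma eq_posF {P : Set Wt} (hP : IsPositiveSystem (rootsT ⊤) P) (hK : posK ⊆ P) :
    ∃ j, P = posF j := by
  obtain ⟨z, hreg, rfl⟩ := hP
  set y := coord z with hy
  have hK' : ∀ v ∈ rootsCompact, 0 < rhoK ⬝ᵥ v → 0 < y ⬝ᵥ intCast v := by
    intro v hv hp
    have := (hK (mem_posK.2 ⟨v, hv, hp, rfl⟩)).2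
    rw [form_wt_right] at this
    linarith
  have key := fun v hv => hK' v (simpleCompact_mem v hv).1 (simpleCompact_mem v hv).2
  have hreg' : ∀ v ∈ rootsF, form z (wt v) ≠ 0 := fun v hv =>
    hreg _ (by rw [rootsT_top]; exact ⟨v, hv, rfl⟩)
  have r1 := hreg' _ longNoncompact_mem.1
  have r2 := hreg' _ longNoncompact_mem.2
  rw [form_wt_right] at r1 r2
  simp [dot_four, ← hy] at key r1 r2
  obtain ⟨h0, h1, h2, h3⟩ := key
  suffices ∃ j, ∀ i, 0 < y ⬝ᵥ intCast (simpleRoot j i) by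
    obtain ⟨j, hj⟩ := this
    exact ⟨j, posF_of_strict hj⟩
  -- Beyond strict `C₄`-dominance only the signs on the long noncompact roots `(1, -1, -1, 1)` and
  -- `(1, -1, -1, -1)` matter. The first exceeds the second by twice the last coordinate, which is
  -- positive, so three sign patterns remain.
  rcases lt_or_gt_of_ne r2 with r2 | r2
  · refine ⟨2, fun i => ?_⟩
    fin_cases i <;> simp [simpleRoot, dot_four] <;> linarith
  · rcases lt_or_gt_of_ne r1 with r1 | r1
    · refine ⟨1, fun i => ?_⟩
      fin_cases i <;> simp [simpleRoot, dot_four] <;> linarith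
    · refine ⟨0, fun i => ?_⟩
      fin_cases i <;> simp [simpleRoot, dot_four] <;> linarith

/-- A vector that is strictly dominant for `C₄` is only orthogonal to long noncompact roots. -/
lemma tau_fixed_of_dot_eq_zero {x : Fin 4 → ℝ}
    (hx : ∀ v ∈ rootsCompact, 0 < rhoK ⬝ᵥ v → 0 < x ⬝ᵥ intCast v) {α : Root}
    (h : x ⬝ᵥ intCast (coord α.1) = 0) : coord α.1 ⬝ᵥ coord α.1 = 4 := by
  have hα := coord_mem_rootsF α
  refine (mem_rootsF.1 hα).resolve_left fun h2 => ?_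
  have hc : coord α.1 ∈ rootsCompact := Finset.mem_filter.2 ⟨hα, Or.inl h2⟩
  have hc' : -coord α.1 ∈ rootsCompact :=
    Finset.mem_filter.2 ⟨neg_mem_rootsF hα, Or.inl (by simpa using h2)⟩
  rcases compact_sign _ hc with h3 | h3
  · exact (hx _ hc h3.1).ne' h
  · have := hx _ hc' (by simpa using h3.1)
    rw [show intCast (-coord α.1) = -intCast (coord α.1) by funext i; simp,
      dotProduct_neg, h, neg_zero] at this
    exact lt_irrefl _ this

lemma root_eq_wt {α : Root} (h : coord α.1 ⬝ᵥ coord α.1 = 4) :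
    intCast α.1 = wt (coord α.1) := by
  funext i
  rw [wt, ← coord_intCast, emb_coord_apply]
  have : α.1 (tau i) = α.1 i := congrFun (congrArg Subtype.val ((tau_fixed_iff α).2 h)) i
  simp [this]

/-- A positive system of `Δ(𝔤, 𝔥_f)` that makes a strictly `𝔨`-dominant weight `x` of `𝔱_f`
dominant is determined by its signs on the simple roots orthogonal to `x`. -/
lemma eq_posE_of_lex {j : Fin 3} {z : Wt} {x : Fin 4 → ℝ}
    (hreg : ∀ α ∈ rootsH, form z α ≠ 0)
    (hdom : IsDominant {α | α ∈ rootsH ∧ 0 < form z α} (emb x))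
    (hx : ∀ v ∈ rootsCompact, 0 < rhoK ⬝ᵥ v → 0 < x ⬝ᵥ intCast v)
    (hlex : ∀ i, 0 < x ⬝ᵥ intCast (simpleRoot j i) ∨
      x ⬝ᵥ intCast (simpleRoot j i) = 0 ∧ 0 < coord z ⬝ᵥ intCast (simpleRoot j i)) :
    {α | α ∈ rootsH ∧ 0 < form z α} = posE j := by
  have main : ∀ α : Root, 0 < form z (intCast α.1) → ∀ i, 0 ≤ coweight j i ⬝ᵥ coord α.1 := by
    intro α hα
    refine (coweight_sign j _ (coord_mem_rootsF α)).resolve_right fun hneg => ?_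
    have h1 := hdom _ ⟨mem_rootsH.2 ⟨α, rfl⟩, hα⟩
    rw [form_emb_root] at h1
    have h2 := sum_coweight j x (coord α.1)
    have hterm : ∀ i ∈ Finset.univ, (coweight j i ⬝ᵥ coord α.1 : ℤ) *
        (x ⬝ᵥ intCast (simpleRoot j i)) ≤ 0 := fun i _ =>
      mul_nonpos_of_nonpos_of_nonneg (Int.cast_nonpos.2 (hneg i))
        ((hlex i).elim le_of_lt fun h => h.1.ge)
    have hsum := Finset.sum_nonpos hterm
    -- A root positive on `z` but a nonpositive combination of the base must be orthogonal to `x`.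
    -- Then it only involves simple roots orthogonal to `x`, where `z` is positive, and it is
    -- determined by its restriction; so `z` cannot be positive on it.
    have h0 : x ⬝ᵥ intCast (coord α.1) = 0 := by linarith
    rw [h0, mul_zero, eq_comm, Finset.sum_eq_zero_iff_of_nonpos hterm] at h2
    rw [root_eq_wt (tau_fixed_of_dot_eq_zero hx h0), form_wt_right] at hα
    have h3 := sum_coweight j (coord z) (coord α.1)
    have : ∑ i, (coweight j i ⬝ᵥ coord α.1 : ℤ) * (coord z ⬝ᵥ intCast (simpleRoot j i)) ≤ 0 := by
      refine Finset.sum_nonpos fun i hi => ?_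
      rcases hlex i with h | h
      · rw [(mul_eq_zero.1 (h2 i hi)).resolve_right h.ne', zero_mul]
      · exact mul_nonpos_of_nonpos_of_nonneg (Int.cast_nonpos.2 (hneg i)) h.2.le
    linarith
  ext β
  constructor
  · rintro ⟨hβ, hpos⟩
    obtain ⟨α, rfl⟩ := mem_rootsH.1 hβ
    rw [intCast_mem_posE, rhoF_dot_pos_iff (coord_mem_rootsF α)]
    exact main α hpos
  · intro hβ
    obtain ⟨α, rfl⟩ := mem_rootsH.1 hβ.1
    refine ⟨hβ.1, ?_⟩
    by_contra hn
    have hlt := lt_of_le_of_ne (not_lt.1 hn) (hreg _ hβ.1)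
    have e : intCast (-α).1 = -intCast α.1 := by
      funext i; exact Int.cast_neg _
    have h1 := main (-α) (by rw [e, form_neg_right]; linarith)
    have h2 := intCast_mem_posE.1 hβ
    have e2 : coord (-α).1 = -coord α.1 := by
      have : (-α).1 = -α.1 := rfl
      rw [this]
      funext i; fin_cases i <;> simp [coord] <;> ring
    rw [← rhoF_dot_pos_iff (coord_mem_rootsF (-α)), e2, dotProduct_neg] at h1
    omega

/-- Without the hypothesis on `x` a positive system of `E₆` need not be stable under `τ`. Strict
`𝔨`-dominance makes `x` nonzero on all roots moved by `τ`, so the only freedom left lies in long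
noncompact roots. -/
lemma eq_posE {P : Set Wt} (hP : IsPositiveSystem rootsH P) {x : Fin 4 → ℝ}
    (hx : ∀ v ∈ rootsCompact, 0 < rhoK ⬝ᵥ v → 0 < x ⬝ᵥ intCast v)
    (hdom : IsDominant P (emb x)) : ∃ j, P = posE j := by
  obtain ⟨z, hreg, rfl⟩ := hP
  set y := coord z with hy
  have key := fun v hv => hx v (simpleCompact_mem v hv).1 (simpleCompact_mem v hv).2
  have long : ∀ v : Fin 4 → ℤ, v ⬝ᵥ v = 4 → y ⬝ᵥ intCast v ≠ 0 ∧
      (0 < y ⬝ᵥ intCast v → 0 ≤ x ⬝ᵥ intCast v) ∧ (y ⬝ᵥ intCast v < 0 → x ⬝ᵥ intCast v ≤ 0) := by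
    intro v h4
    have aux : ∀ v : Fin 4 → ℤ, v ⬝ᵥ v = 4 → y ⬝ᵥ intCast v ≠ 0 ∧
        (0 < y ⬝ᵥ intCast v → 0 ≤ x ⬝ᵥ intCast v) := by
      intro v h4
      obtain ⟨α, rfl⟩ := exists_root_coord (mem_rootsF.2 (Or.inr h4))
      have hα : wt (coord α.1) ∈ rootsH := mem_rootsH.2 ⟨α, (root_eq_wt h4).symm⟩
      have h1 := hreg _ hα
      rw [form_wt_right] at h1
      refine ⟨fun h => h1 (by rw [← hy, h, zero_div]), fun h => ?_⟩
      have h2 := hdom _ ⟨hα, by rw [form_wt_right]; linarith⟩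
      rw [form_wt_right, coord_emb] at h2
      linarith
    refine ⟨(aux v h4).1, (aux v h4).2, fun h => ?_⟩
    have h5 := (aux (-v) (by simpa using h4)).2
    rw [show intCast (-v) = -intCast v by funext i; simp, dotProduct_neg, dotProduct_neg] at h5
    linarith [h5 (by linarith)]
  obtain ⟨r1, p1, n1⟩ := long ![1, -1, -1, -1] (by simp)
  obtain ⟨r2, p2, n2⟩ := long ![1, -1, -1, 1] (by simp)
  simp [dot_four] at key r1 p1 n1 r2 p2 n2
  obtain ⟨h0, h1, h2, h3⟩ := key
  have split : ∀ a b : ℝ, 0 ≤ a → 0 < b → (0 < a ∨ a = 0 ∧ 0 < b) := fun a b ha hb =>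
    (lt_or_eq_of_le ha).imp id fun h => ⟨h.symm, hb⟩
  suffices ∃ j, ∀ i, 0 < x ⬝ᵥ intCast (simpleRoot j i) ∨
      x ⬝ᵥ intCast (simpleRoot j i) = 0 ∧ 0 < y ⬝ᵥ intCast (simpleRoot j i) by
    obtain ⟨j, hj⟩ := this
    exact ⟨j, eq_posE_of_lex hreg hdom hx hj⟩
  -- The signs of the regular element `y` choose `j`. Dominance of `x` gives the same inequalities
  -- only weakly, and `y` breaks the ties.
  rcases lt_or_gt_of_ne r2 with r2 | r2
  · have n2 := n2 (by linarith)
    refine ⟨2, fun i => ?_⟩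
    fin_cases i
    · exact split _ _ (by simp [simpleRoot, dot_four]; linarith)
        (by simp [simpleRoot, dot_four]; linarith)
    all_goals left; simp [simpleRoot, dot_four]; linarith
  · have p2 := p2 (by linarith)
    rcases lt_or_gt_of_ne r1 with r1 | r1
    · have n1 := n1 (by linarith)
      refine ⟨1, fun i => ?_⟩
      fin_cases i
      · exact split _ _ (by simp [simpleRoot, dot_four]; linarith)
          (by simp [simpleRoot, dot_four]; linarith)
      · exact split _ _ (by simp [simpleRoot, dot_four]; linarith)
          (by simp [simpleRoot, dot_four]; linarith)
      all_goals left; simp [simpleRoot, dot_four]; linarith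
    · have p1 := p1 (by linarith)
      refine ⟨0, fun i => ?_⟩
      fin_cases i
      pick_goal 4
      · exact split _ _ (by simp [simpleRoot, dot_four]; linarith)
          (by simp [simpleRoot, dot_four]; linarith)
      all_goals left; simp [simpleRoot, dot_four]; linarith

/-! ### The Weyl group of `𝔨` -/

/-- The reflection in `g` for integral vectors (meaningful if the quotient is integral). -/
def reflInt (g v : Fin 4 → ℤ) : Fin 4 → ℤ := v - (2 * (g ⬝ᵥ v) / (g ⬝ᵥ g)) • g

/-- The reflection permutes the compact roots and is an involution; the last clause says that the
integer division in `reflInt` is exact. -/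
lemma reflInt_compact : ∀ g ∈ rootsCompact, ∀ v ∈ rootsCompact,
    (reflInt g v ⬝ᵥ reflInt g v = 2 ∨
      reflInt g v ⬝ᵥ reflInt g v = 4 ∧ reflInt g v 0 % 2 = 0) ∧
    reflInt g (reflInt g v) = v ∧
    2 * (g ⬝ᵥ v) / (g ⬝ᵥ g) * (g ⬝ᵥ g) = 2 * (g ⬝ᵥ v) := by
  decide +kernel

lemma mem_rootsCompact {v : Fin 4 → ℤ} :
    v ∈ rootsCompact ↔ v ⬝ᵥ v = 2 ∨ v ⬝ᵥ v = 4 ∧ v 0 % 2 = 0 := by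
  rw [rootsCompact, Finset.mem_filter, mem_rootsF]
  omega

lemma neg_mem_rootsCompact {v : Fin 4 → ℤ} (hv : v ∈ rootsCompact) : -v ∈ rootsCompact := by
  rw [mem_rootsCompact] at hv ⊢
  simpa using hv

/-- The sum of the absolute values of the pairings with the compact roots. -/
noncomputable def absSum (u : Fin 4 → ℝ) : ℝ := ∑ v ∈ rootsCompact, |u ⬝ᵥ intCast v|

lemma intCast_neg {ι : Type*} (v : ι → ℤ) : intCast (-v) = -intCast v := by
  funext i; simp

lemma intCast_zsmul {ι : Type*} (k : ℤ) (v : ι → ℤ) : intCast (k • v) = (k : ℝ) • intCast v := by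
  funext i; simp

lemma absSum_eq (u : Fin 4 → ℝ) :
    absSum u = 2 * ∑ v ∈ rootsCompact with 0 < rhoK ⬝ᵥ v, |u ⬝ᵥ intCast v| := by
  rw [absSum, ← Finset.sum_filter_add_sum_filter_not _ (fun v => 0 < rhoK ⬝ᵥ v), two_mul]
  congr 1
  refine Finset.sum_nbij' Neg.neg Neg.neg (fun v hv => ?_) (fun v hv => ?_)
    (fun v _ => neg_neg v) (fun v _ => neg_neg v) fun v _ => ?_
  · rw [Finset.mem_filter] at hv ⊢
    refine ⟨neg_mem_rootsCompact hv.1, ?_⟩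
    rw [dotProduct_neg]
    rcases compact_sign v hv.1 with h | h
    · exact absurd h.1 hv.2
    · linarith [h.1]
  · rw [Finset.mem_filter] at hv ⊢
    refine ⟨neg_mem_rootsCompact hv.1, ?_⟩
    rw [dotProduct_neg]
    linarith [hv.2]
  · rw [intCast_neg, dotProduct_neg, abs_neg]

lemma sum_posK_dot (u : Fin 4 → ℝ) :
    ∑ v ∈ rootsCompact with 0 < rhoK ⬝ᵥ v, u ⬝ᵥ intCast v = 2 * (u ⬝ᵥ intCast rhoK) := by
  rw [← dotProduct_sum, show ∑ v ∈ rootsCompact with 0 < rhoK ⬝ᵥ v, intCast v =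
    intCastHom (Fin 4) (∑ v ∈ rootsCompact with 0 < rhoK ⬝ᵥ v, v) from
    (map_sum (intCastHom (Fin 4)) _ _).symm, sum_rootsCompact, map_nsmul, dotProduct_smul,
    nsmul_eq_mul]
  rfl

lemma rhoK_le_absSum (u : Fin 4 → ℝ) : 4 * (u ⬝ᵥ intCast rhoK) ≤ absSum u := by
  have := Finset.sum_le_sum fun v (_ : v ∈ rootsCompact.filter fun v => 0 < rhoK ⬝ᵥ v) =>
    le_abs_self (u ⬝ᵥ intCast v)
  rw [sum_posK_dot] at this
  rw [absSum_eq]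
  linarith

/-- `2ρ_c` is the sum of the positive compact roots, so equality in `rhoK_le_absSum` means that no
pairing with a positive compact root is negative. -/
lemma absSum_eq_iff (u : Fin 4 → ℝ) : absSum u = 4 * (u ⬝ᵥ intCast rhoK) ↔ DomK u := by
  have key := Finset.sum_eq_sum_iff_of_le
    fun v (_ : v ∈ rootsCompact.filter fun v => 0 < rhoK ⬝ᵥ v) => le_abs_self (u ⬝ᵥ intCast v)
  rw [sum_posK_dot] at key
  rw [absSum_eq]
  constructor
  · intro h
    refine domK_of_dot fun v hv hp => ?_
    rw [key.1 (by linarith) v (Finset.mem_filter.2 ⟨hv, hp⟩)]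
    exact abs_nonneg _
  · intro h
    have := key.2 fun v hv => (abs_of_nonneg (domK_dot_nonneg h (Finset.mem_filter.1 hv).1
      (Finset.mem_filter.1 hv).2)).symm
    linarith

lemma refl_wt_emb (g : Fin 4 → ℤ) (u : Fin 4 → ℝ) : refl (wt g) (emb u) =
    emb (u - (2 * (u ⬝ᵥ intCast g) / (intCast g ⬝ᵥ intCast g)) • intCast g) := by
  rw [map_sub, map_smul]
  change emb u - pairing _ _ • _ = _
  rw [pairing, wt, form_emb_emb, form_emb_emb]
  congr 2
  rw [mul_div_assoc', div_div_div_cancel_right₀ two_ne_zero]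

lemma dot_self_ne_zero {g : Fin 4 → ℤ} (hg : g ∈ rootsCompact) :
    intCast g ⬝ᵥ intCast g ≠ (0 : ℝ) := by
  rw [dot_intCast]
  have := mem_rootsCompact.1 hg
  exact_mod_cast (by omega : g ⬝ᵥ g ≠ 0)

lemma absSum_refl {g : Fin 4 → ℤ} (hg : g ∈ rootsCompact) (u : Fin 4 → ℝ) :
    absSum (u - (2 * (u ⬝ᵥ intCast g) / (intCast g ⬝ᵥ intCast g)) • intCast g) = absSum u := by
  have hmem : ∀ v ∈ rootsCompact, reflInt g v ∈ rootsCompact := fun v hv =>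
    mem_rootsCompact.2 (reflInt_compact g hg v hv).1
  have hinv : ∀ v ∈ rootsCompact, reflInt g (reflInt g v) = v := fun v hv =>
    (reflInt_compact g hg v hv).2.1
  refine Finset.sum_nbij' (reflInt g) (reflInt g) hmem hmem hinv hinv fun v hv => ?_
  have h0 := dot_self_ne_zero hg
  have h := (reflInt_compact g hg v hv).2.2
  congr 1
  rw [reflInt, intCast_sub, intCast_zsmul, sub_dotProduct, dotProduct_sub, smul_dotProduct,
    dotProduct_smul, smul_eq_mul, smul_eq_mul]
  have e : ((2 * (g ⬝ᵥ v) / (g ⬝ᵥ g) : ℤ) : ℝ) * (intCast g ⬝ᵥ intCast g) =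
      2 * (intCast g ⬝ᵥ intCast v) := by
    rw [dot_intCast, dot_intCast]; exact_mod_cast h
  rw [← eq_div_iff h0] at e
  rw [e]
  ring

lemma dot_refl {g : Fin 4 → ℤ} (hg : g ∈ rootsCompact) (u : Fin 4 → ℝ) :
    (u - (2 * (u ⬝ᵥ intCast g) / (intCast g ⬝ᵥ intCast g)) • intCast g) ⬝ᵥ
      (u - (2 * (u ⬝ᵥ intCast g) / (intCast g ⬝ᵥ intCast g)) • intCast g) = u ⬝ᵥ u := by
  have h0 := dot_self_ne_zero hg
  simp only [sub_dotProduct, dotProduct_sub, smul_dotProduct, dotProduct_smul, smul_eq_mul]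
  rw [dotProduct_comm (intCast g) u]
  field_simp
  ring

/-- Each generating reflection is an isometry permuting the compact roots. These two invariants
suffice to compute the norm of `{ν} + ρ_c`. -/
lemma weylK_emb {w : Module.End ℝ Wt} (hw : w ∈ weylK) : ∀ u : Fin 4 → ℝ,
    ∃ u', w (emb u) = emb u' ∧ u' ⬝ᵥ u' = u ⬝ᵥ u ∧ absSum u' = absSum u := by
  rw [weylK] at hw
  induction hw using Submonoid.closure_induction with
  | mem w hw =>
    intro u
    rw [rootsT_kk] at hw
    obtain ⟨_, ⟨g, hg, rfl⟩, rfl⟩ := hw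
    exact ⟨_, refl_wt_emb g u, dot_refl hg u, absSum_refl hg u⟩
  | one => exact fun u => ⟨u, rfl, rfl, rfl⟩
  | mul w w' _ _ ih ih' =>
    intro u
    obtain ⟨u', h1, h2, h3⟩ := ih' u
    obtain ⟨u'', h1', h2', h3'⟩ := ih u'
    exact ⟨u'', by rw [Module.End.mul_apply, h1, h1'], h2'.trans h2, h3'.trans h3⟩

lemma refl_wt_wt {g n : Fin 4 → ℤ} (hg : g ∈ rootsCompact) {k : ℤ}
    (hk : 2 * (n ⬝ᵥ g) = k * (g ⬝ᵥ g)) : refl (wt g) (wt n) = wt (n - k • g) := by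
  have h0 := dot_self_ne_zero hg
  change refl (wt g) (emb (intCast n)) = emb (intCast (n - k • g))
  rw [refl_wt_emb, intCast_sub, intCast_zsmul]
  congr 3
  rw [div_eq_iff h0, dot_intCast, dot_intCast]
  exact_mod_cast hk

/-- A crude bound, used only to make `10 (n, n) - (ρ_c, n)` a natural number that can serve as a
termination measure. -/
lemma rhoK_dot_le (n : Fin 4 → ℤ) : rhoK ⬝ᵥ n ≤ 10 * (n ⬝ᵥ n) := by
  have hs := fun i => Int.le_self_sq (n i)
  have h0 := fun i => sq_nonneg (n i)
  simp only [dot_four, rhoK]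
  simp
  linarith [hs 0, hs 1, hs 2, hs 3, h0 0, h0 1, h0 2, h0 3]

lemma exists_dominant (n : Fin 4 → ℤ) : ∃ w ∈ weylK, ∃ m, w (wt n) = wt m ∧ DomK (intCast m) := by
  induction h : (10 * (n ⬝ᵥ n) - rhoK ⬝ᵥ n).toNat using Nat.strong_induction_on generalizing n with
  | _ N ih =>
  subst h
  -- Reflecting in a simple compact root on which `n` is negative keeps the length and increases the
  -- pairing with `ρ_c`, so the measure drops.
  have step : ∀ g ∈ rootsCompact, ∀ k : ℤ, 2 * (n ⬝ᵥ g) = k * (g ⬝ᵥ g) → k * (rhoK ⬝ᵥ g) < 0 →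
      ∃ w ∈ weylK, ∃ m, w (wt n) = wt m ∧ DomK (intCast m) := by
    intro g hg k hk hneg
    have hn : (n - k • g) ⬝ᵥ (n - k • g) = n ⬝ᵥ n := by
      simp only [sub_dotProduct, dotProduct_sub, smul_dotProduct, dotProduct_smul, smul_eq_mul]
      rw [dotProduct_comm g n]
      linear_combination -k * hk
    have hr : rhoK ⬝ᵥ (n - k • g) = rhoK ⬝ᵥ n - k * (rhoK ⬝ᵥ g) := by
      rw [dotProduct_sub, dotProduct_smul, smul_eq_mul]
    have hb := rhoK_dot_le (n - k • g)
    rw [hn] at hb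
    have hlt : (10 * ((n - k • g) ⬝ᵥ (n - k • g)) - rhoK ⬝ᵥ (n - k • g)).toNat <
        (10 * (n ⬝ᵥ n) - rhoK ⬝ᵥ n).toNat := by
      rw [hn]
      generalize k * (rhoK ⬝ᵥ g) = t at hneg hr
      omega
    obtain ⟨w, hw, m, h1, h2⟩ := ih _ hlt (n - k • g) rfl
    refine ⟨w * refl (wt g), weylK.mul_mem hw (Submonoid.subset_closure ⟨wt g, ?_, rfl⟩), m, ?_, h2⟩
    · rw [rootsT_kk]; exact ⟨g, hg, rfl⟩
    · rw [Module.End.mul_apply, refl_wt_wt hg hk, h1]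
  have smem := fun g hg => (simpleCompact_mem g hg).1
  simp only [List.forall_mem_cons] at smem
  obtain ⟨g0, g1, g2, g3, -⟩ := smem
  by_cases h0 : n 0 < n 1
  · exact step _ g0 (n 0 - n 1) (by rw [dot_four, dot_four]; simp; ring) (by simp [rhoK]; omega)
  by_cases h1 : n 1 < n 2
  · exact step _ g1 (n 1 - n 2) (by rw [dot_four, dot_four]; simp; ring) (by simp [rhoK]; omega)
  by_cases h2 : n 2 < n 3
  · exact step _ g2 (n 2 - n 3) (by rw [dot_four, dot_four]; simp; ring) (by simp [rhoK]; omega)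
  by_cases h3 : n 3 < 0
  · exact step _ g3 (n 3) (by rw [dot_four, dot_four]; simp; ring) (by simp [rhoK]; omega)
  refine ⟨1, weylK.one_mem, n, rfl, ?_, ?_, ?_, ?_⟩ <;> simp <;> omega

/-! ### The spin norm -/

/-- The square length of `{ν} + ρ_c`, where `ν` has coordinates `u`. -/
noncomputable def spinSq (u : Fin 4 → ℝ) : ℝ := (u ⬝ᵥ u + absSum u / 2 + 30) / 2

lemma rhoK_dot_rhoK : intCast rhoK ⬝ᵥ intCast rhoK = (30 : ℝ) := by
  rw [dot_intCast]; simp [rhoK]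

lemma form_add_rhoC (u : Fin 4 → ℝ) : form (emb u + wt rhoK) (emb u + wt rhoK) =
    (u ⬝ᵥ u + 2 * (u ⬝ᵥ intCast rhoK) + 30) / 2 := by
  rw [wt, ← map_add, form_emb_emb, add_dotProduct, dotProduct_add, dotProduct_add,
    rhoK_dot_rhoK, dotProduct_comm (intCast rhoK) u]
  ring

lemma form_le_spinSq (u : Fin 4 → ℝ) :
    form (emb u + wt rhoK) (emb u + wt rhoK) ≤ spinSq u := by
  rw [form_add_rhoC, spinSq]
  linarith [rhoK_le_absSum u]

lemma form_eq_spinSq_iff (u : Fin 4 → ℝ) :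
    form (emb u + wt rhoK) (emb u + wt rhoK) = spinSq u ↔ DomK u := by
  rw [form_add_rhoC, spinSq, ← absSum_eq_iff]
  constructor <;> intro h <;> linarith

lemma spin_set_eq (κ : ℝ) (n : Fin 4 → ℤ) :
    {r | ∃ P, IsPositiveSystem (rootsT ⊤) P ∧ posK ⊆ P ∧ ∃ w ∈ weylK,
      IsDominant posK (w (wt n - halfSum (P ∩ rootsT pp))) ∧
      r = wtNorm κ (w (wt n - halfSum (P ∩ rootsT pp)) + rhoC)} =
    Set.range fun j => √(κ * spinSq (intCast (n - rhoN j))) := by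
  have key : ∀ j, ∀ w ∈ weylK, IsDominant posK (w (wt (n - rhoN j))) →
      wtNorm κ (w (wt (n - rhoN j)) + rhoC) = √(κ * spinSq (intCast (n - rhoN j))) := by
    intro j w hw hd
    obtain ⟨u, h1, h2, h3⟩ := weylK_emb hw (intCast (n - rhoN j))
    rw [wt, h1, isDominant_posK] at hd
    rw [wt, h1, rhoC_eq, wtNorm, (form_eq_spinSq_iff u).2 hd, spinSq, spinSq, h2, h3]
  ext r
  constructor
  · rintro ⟨P, hP, hK, w, hw, hd, rfl⟩
    obtain ⟨j, rfl⟩ := eq_posF hP hK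
    rw [halfSum_posF_inter, ← wt_sub] at hd ⊢
    exact ⟨j, (key j w hw hd).symm⟩
  · rintro ⟨j, rfl⟩
    obtain ⟨w, hw, m, h1, h2⟩ := exists_dominant (n - rhoN j)
    have hd : IsDominant posK (w (wt (n - rhoN j))) := by
      rw [h1]; exact isDominant_posK.2 h2
    refine ⟨posF j, isPositiveSystem_posF j, posK_subset_posF j, w, hw, ?_, ?_⟩
    · rwa [halfSum_posF_inter, ← wt_sub]
    · rw [halfSum_posF_inter, ← wt_sub]
      exact (key j w hw hd).symm

lemma spinNorm_attained (κ : ℝ) (n : Fin 4 → ℤ) :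
    ∃ j, spinNorm κ (wt n) = √(κ * spinSq (intCast (n - rhoN j))) := by
  rw [spinNorm, spin_set_eq]
  obtain ⟨j, hj⟩ := (Set.range_nonempty _).csInf_mem
    (Set.finite_range fun j => √(κ * spinSq (intCast (n - rhoN j))))
  exact ⟨j, hj.symm⟩

lemma spinNorm_le (κ : ℝ) (n : Fin 4 → ℤ) (j : Fin 3) :
    spinNorm κ (wt n) ≤ √(κ * spinSq (intCast (n - rhoN j))) := by
  rw [spinNorm, spin_set_eq]
  exact csInf_le (Set.finite_range _).bddBelow ⟨j, rfl⟩

/-! ### Projections to chambers -/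

lemma form_smul_smul (c : ℝ) (y : Wt) : form (c • y) (c • y) = c ^ 2 * form y y := by
  rw [form_smul_left, form_smul_right]; ring

lemma IsChamberProj.form_sub_eq_zero {P : Set Wt} {v y : Wt} (h : IsChamberProj P v y) :
    form (v - y) y = 0 := by
  -- The ray through `y` stays in the cone, so `(1 + s) y` competes with `y` for every `s ≥ -1`.
  have hs : ∀ s : ℝ, -1 ≤ s → 0 ≤ -2 * s * form (v - y) y + s ^ 2 * form y y := by
    intro s hs
    have h1 := h.2 ((1 + s) • y) fun α hα => by
      rw [form_smul_left]; exact mul_nonneg (by linarith) (h.1 α hα)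
    have e : v - (1 + s) • y = (v - y) - s • y := by rw [add_smul, one_smul]; abel
    rw [e, form_sub_left (v - y) (s • y), form_sub_right (v - y) (v - y),
      form_sub_right (s • y) (v - y), form_smul_smul, form_smul_left, form_smul_right,
      form_comm y (v - y)] at h1
    linarith
  have hb := real_form_nonneg y
  set a := form (v - y) y
  set b := form y y
  by_contra ha
  have hd : 0 < |a| + b := by positivity
  -- This `s` has the sign of `a` and is at least `-1`, and it makes the quadratic negative unless
  -- `a = 0`. Adding `|a|` to the denominator also covers `b = 0`.
  have h1 := hs (a / (|a| + b)) (by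
    rw [le_div_iff₀ hd]; linarith [neg_abs_le a])
  have h2 : -2 * (a / (|a| + b)) * a + (a / (|a| + b)) ^ 2 * b =
      -(a ^ 2 * (2 * |a| + b) / (|a| + b) ^ 2) := by
    field_simp; ring
  rw [h2] at h1
  have : 0 < a ^ 2 * (2 * |a| + b) / (|a| + b) ^ 2 := by positivity
  linarith

lemma IsChamberProj.form_eq {P : Set Wt} {v y : Wt} (h : IsChamberProj P v y) :
    form v v = form y y + form (v - y) (v - y) := by
  have h1 := h.form_sub_eq_zero
  have h2 : v = (v - y) + y := by abel
  nth_rewrite 1 2 [h2]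
  rw [form_add_left, form_add_right, form_add_right, form_comm y (v - y), h1]
  ring

lemma IsChamberProj.form_le {P : Set Wt} {v y : Wt} (h : IsChamberProj P v y) :
    form y y ≤ form v v := by
  rw [h.form_eq]; linarith [real_form_nonneg (v - y)]

lemma IsChamberProj.eq_of_form_le {P : Set Wt} {v y : Wt} (h : IsChamberProj P v y)
    (h1 : form v v ≤ form y y) : y = v := by
  rw [h.form_eq] at h1
  exact (sub_eq_zero.1 (real_form_eq_zero
    (le_antisymm (by linarith) (real_form_nonneg (v - y))))).symm

lemma IsChamberProj.eq_of_isDominant {P : Set Wt} {v y : Wt} (h : IsChamberProj P v y)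
    (hv : IsDominant P v) : y = v := by
  have h1 := h.2 v hv
  rw [sub_self, show form (0 : Wt) 0 = 0 by simp [form]] at h1
  exact (sub_eq_zero.1 (real_form_eq_zero (le_antisymm h1 (real_form_nonneg (v - y))))).symm

lemma isChamberProj_self {P : Set Wt} {v : Wt} (hv : IsDominant P v) : IsChamberProj P v v := by
  refine ⟨hv, fun z _ => ?_⟩
  rw [sub_self, show form (0 : Wt) 0 = 0 by simp [form]]
  exact real_form_nonneg _

lemma continuous_form {f g : Wt → Wt} (hf : Continuous f) (hg : Continuous g) :
    Continuous fun z => form (f z) (g z) := by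
  simp only [form]; fun_prop

/-- Coercivity of the form, needed for compactness of its sublevel sets. The constant 6 is the
largest diagonal entry of the inverse Cartan matrix of `E₆`. -/
lemma norm_sq_le_form (x : Wt) : ‖x‖ ^ 2 ≤ 6 * form x x := by
  have key : ∀ i, ‖x i‖ ≤ √(6 * form x x) := by
    intro i
    refine Real.abs_le_sqrt ?_
    have e := real_form_sos x
    fin_cases i <;> simp <;>
      nlinarith [sq_nonneg (2 * x 0 - x 2), sq_nonneg (2 * x 1 - x 3), sq_nonneg (2 * x 5 - x 4),
        sq_nonneg (3 * x 2 - 2 * x 3), sq_nonneg (3 * x 4 - 2 * x 3), sq_nonneg (x 3),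
        sq_nonneg (3 * (2 * x 0 - x 2) - (3 * x 2 - 2 * x 3)),
        sq_nonneg (3 * (2 * x 0 - x 2) - 2 * x 3), sq_nonneg ((3 * x 2 - 2 * x 3) - 2 * x 3),
        sq_nonneg (3 * (2 * x 5 - x 4) - (3 * x 4 - 2 * x 3)),
        sq_nonneg (3 * (2 * x 5 - x 4) - 2 * x 3), sq_nonneg ((3 * x 4 - 2 * x 3) - 2 * x 3)]
  have h := (pi_norm_le_iff_of_nonneg (Real.sqrt_nonneg _)).2 key
  calc ‖x‖ ^ 2 ≤ √(6 * form x x) ^ 2 := by gcongr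
    _ = _ := Real.sq_sqrt (by linarith [real_form_nonneg x])

lemma exists_isChamberProj (P : Set Wt) (v : Wt) : ∃ y, IsChamberProj P v y := by
  have hcl : IsClosed {z | IsDominant P z} := by
    have : {z | IsDominant P z} = ⋂ α ∈ P, {z | 0 ≤ form z α} := by
      ext z; simp [IsDominant]
    rw [this]
    exact isClosed_biInter fun α _ =>
      isClosed_le continuous_const (continuous_form continuous_id continuous_const)
  have hcont : Continuous fun z => form (v - z) (v - z) :=
    continuous_form (by fun_prop) (by fun_prop)
  -- Since 0 lies in the cone, the minimum may be sought among points no farther from `v` than 0.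
  have hK : IsCompact ({z | IsDominant P z} ∩ {z | form (v - z) (v - z) ≤ form v v}) := by
    refine Metric.isCompact_of_isClosed_isBounded
      (hcl.inter (isClosed_le hcont continuous_const)) ?_
    refine (Metric.isBounded_closedBall (x := v) (r := √(6 * form v v))).subset fun z hz => ?_
    rw [Metric.mem_closedBall, dist_comm, dist_eq_norm]
    refine Real.le_sqrt_of_sq_le ((norm_sq_le_form _).trans ?_)
    have : form (v - z) (v - z) ≤ form v v := hz.2
    linarith
  have h0 : IsDominant P 0 := fun α _ => by simp [form]
  obtain ⟨y, hy, hmin⟩ := hK.exists_isMinOn ⟨0, h0, by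
    change form (v - 0) (v - 0) ≤ form v v; rw [sub_zero]⟩ hcont.continuousOn
  refine ⟨y, hy.1, fun z hz => ?_⟩
  rcases le_total (form (v - z) (v - z)) (form v v) with h | h
  · exact hmin ⟨hz, h⟩
  · exact le_trans hy.2 h

/-! ### Comparison of the norms -/

lemma dot_rhoF_self (j : Fin 3) : intCast (rhoF j) ⬝ᵥ intCast (rhoF j) = (156 : ℝ) := by
  rw [dot_intCast]; fin_cases j <;> simp [rhoF]

/-- A vector that is dominant for the positive system `j` pairs at least as well with its half
sum as with the other ones. -/
lemma DomF.dot_rhoF_le {j : Fin 3} {x : Fin 4 → ℝ} (h : DomF j x) (i : Fin 3) :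
    x ⬝ᵥ intCast (rhoF i) ≤ x ⬝ᵥ intCast (rhoF j) := by
  have h0 := h 0
  have h1 := h 1
  have h2 := h 2
  have h3 := h 3
  -- Each difference `rhoF j - rhoF i` is a nonnegative combination of the simple roots of the
  -- system `j`.
  fin_cases j <;> fin_cases i <;> simp [simpleRoot, rhoF, dot_four] at * <;> linarith

lemma rhoF_dot_lt {i j : Fin 3} (h : i ≠ j) : rhoF j ⬝ᵥ rhoF i < rhoF j ⬝ᵥ rhoF j := by
  revert i j; decide

lemma DomF.dot_rhoF_lt {i j : Fin 3} {u : Fin 4 → ℝ} (h : DomF j u) (hij : i ≠ j) :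
    (u + intCast (rhoF j)) ⬝ᵥ intCast (rhoF i) < (u + intCast (rhoF j)) ⬝ᵥ intCast (rhoF j) := by
  rw [add_dotProduct, add_dotProduct, dot_intCast, dot_intCast]
  have : ((rhoF j ⬝ᵥ rhoF i : ℤ) : ℝ) < (rhoF j ⬝ᵥ rhoF j : ℤ) := by
    exact_mod_cast rhoF_dot_lt hij
  linarith [h.dot_rhoF_le i]

/-- The coordinates of `μ + ρ_c - ρ_n^(j) = μ + 2 ρ_c - ρ'`. -/
def shifted (n : Fin 4 → ℤ) (j : Fin 3) : Fin 4 → ℤ := n - rhoN j + rhoK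

lemma wt_shifted (n : Fin 4 → ℤ) (j : Fin 3) :
    wt (shifted n j) = emb (intCast (n - rhoN j)) + wt rhoK := wt_add _ _

lemma wt_add_two_rhoC (n : Fin 4 → ℤ) : wt n + (2 : ℝ) • rhoC = emb (intCast (n + 2 • rhoK)) := by
  change _ = wt _
  rw [wt_add, rhoC_eq, two_smul, two_smul, wt_add]

lemma shifted_eq (n : Fin 4 → ℤ) (j : Fin 3) : shifted n j = n + 2 • rhoK - rhoF j := by
  rw [shifted, ← rhoK_add_rhoN, two_smul]; abel

lemma wt_add_two_rhoC_sub (n : Fin 4 → ℤ) (j : Fin 3) :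
    wt n + (2 : ℝ) • rhoC - halfSum (posE j) = wt (shifted n j) := by
  rw [halfSum_posE, wt_add_two_rhoC, shifted_eq, wt_sub]; rfl

/-- As all `ρ'_j` have the same length, only the last term depends on `j`. -/
lemma form_shifted (n : Fin 4 → ℤ) (j : Fin 3) : form (wt (shifted n j)) (wt (shifted n j)) =
    (intCast (n + 2 • rhoK) ⬝ᵥ intCast (n + 2 • rhoK) + 156) / 2 -
      intCast (n + 2 • rhoK) ⬝ᵥ intCast (rhoF j) := by
  rw [shifted_eq, wt, form_emb_emb, intCast_sub]
  simp only [sub_dotProduct, dotProduct_sub, dot_rhoF_self,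
    dotProduct_comm (intCast (rhoF j)) (intCast (n + 2 • rhoK))]
  ring

lemma form_shifted_le {n : Fin 4 → ℤ} {j : Fin 3} (h : DomF j (intCast (n + 2 • rhoK)))
    (i : Fin 3) : form (wt (shifted n j)) (wt (shifted n j)) ≤
      form (wt (shifted n i)) (wt (shifted n i)) := by
  rw [form_shifted, form_shifted]
  linarith [h.dot_rhoF_le i]

lemma strict_of_domK {n : Fin 4 → ℤ} (hn : DomK (intCast n)) :
    ∀ v ∈ rootsCompact, 0 < rhoK ⬝ᵥ v → 0 < intCast (n + 2 • rhoK) ⬝ᵥ intCast v := by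
  intro v hv hp
  have h1 := domK_dot_nonneg hn hv hp
  rw [intCast_add, add_dotProduct]
  have : intCast (2 • rhoK) ⬝ᵥ intCast v = ((2 * (rhoK ⬝ᵥ v) : ℤ) : ℝ) := by
    rw [dot_intCast, smul_dotProduct]; simp
  rw [this]
  have : (0 : ℝ) < (2 * (rhoK ⬝ᵥ v) : ℤ) := by exact_mod_cast (by omega : 0 < 2 * (rhoK ⬝ᵥ v))
  linarith

lemma exists_domF {x : Fin 4 → ℝ} (hx : DomK x) : ∃ j, DomF j x := by
  obtain ⟨h1, h2, h3, h4⟩ := hx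
  rcases le_total (x 0 - x 1 - x 2 + x 3) 0 with r2 | r2
  · refine ⟨2, fun i => ?_⟩
    fin_cases i <;> simp [simpleRoot, dot_four] <;> linarith
  · rcases le_total (x 0 - x 1 - x 2 - x 3) 0 with r1 | r1
    · refine ⟨1, fun i => ?_⟩
      fin_cases i <;> simp [simpleRoot, dot_four] <;> linarith
    · refine ⟨0, fun i => ?_⟩
      fin_cases i <;> simp [simpleRoot, dot_four] <;> linarith

lemma domK_of_strict {n : Fin 4 → ℤ} (hn : DomK (intCast n)) :
    DomK (intCast (n + 2 • rhoK)) :=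
  domK_of_dot fun v hv hp => (strict_of_domK hn v hv hp).le

lemma lambda_set_eq (κ : ℝ) {n : Fin 4 → ℤ} (hn : DomK (intCast n)) :
    {r | ∃ P y, IsPositiveSystem rootsH P ∧ IsDominant P (wt n + (2 : ℝ) • rhoC) ∧
      IsChamberProj P (wt n + (2 : ℝ) • rhoC - halfSum P) y ∧ r = wtNorm κ y} =
    {r | ∃ j y, DomF j (intCast (n + 2 • rhoK)) ∧
      IsChamberProj (posE j) (wt (shifted n j)) y ∧ r = wtNorm κ y} := by
  ext r
  constructor
  · rintro ⟨P, y, hP, hdom, hy, rfl⟩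
    rw [wt_add_two_rhoC] at hdom
    obtain ⟨j, rfl⟩ := eq_posE hP (strict_of_domK hn) hdom
    rw [wt_add_two_rhoC_sub] at hy
    exact ⟨j, y, isDominant_posE.1 hdom, hy, rfl⟩
  · rintro ⟨j, y, hdom, hy, rfl⟩
    refine ⟨posE j, y, isPositiveSystem_posE j, ?_, ?_, rfl⟩
    · rw [wt_add_two_rhoC]; exact isDominant_posE.2 hdom
    · rwa [wt_add_two_rhoC_sub]

lemma lambdaNorm_le (κ : ℝ) {n : Fin 4 → ℤ} (hn : DomK (intCast n)) {j : Fin 3} {y : Wt}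
    (hj : DomF j (intCast (n + 2 • rhoK))) (hy : IsChamberProj (posE j) (wt (shifted n j)) y) :
    lambdaNorm κ (wt n) ≤ wtNorm κ y := by
  rw [lambdaNorm, lambda_set_eq κ hn]
  refine csInf_le ⟨0, ?_⟩ ⟨j, y, hj, hy, rfl⟩
  rintro _ ⟨_, _, _, _, rfl⟩
  exact Real.sqrt_nonneg _

lemma intCast_add_two_rhoK (n : Fin 4 → ℤ) (j : Fin 3) :
    intCast (n + 2 • rhoK) = intCast (shifted n j) + intCast (rhoF j) := by
  rw [shifted_eq, ← intCast_add, sub_add_cancel]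

lemma domF_rhoF (j : Fin 3) : DomF j (intCast (rhoF j)) := fun i => (rhoF_strict j i).le

lemma domF_of_shifted {n : Fin 4 → ℤ} {j : Fin 3} (h : DomF j (intCast (shifted n j))) :
    DomF j (intCast (n + 2 • rhoK)) := fun i => by
  rw [intCast_add_two_rhoK n j, add_dotProduct]
  exact add_nonneg (h i) (domF_rhoF j i)

/-- Adding `ρ'_j` to a `j`-dominant vector gives a strictly `j`-dominant one, so no other system
makes `μ + 2ρ_c` dominant, and the projection does nothing. -/
lemma lambdaNorm_of_shifted (κ : ℝ) {n : Fin 4 → ℤ} (hn : DomK (intCast n)) {j : Fin 3}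
    (h : DomF j (intCast (shifted n j))) : lambdaNorm κ (wt n) = wtNorm κ (wt (shifted n j)) := by
  rw [lambdaNorm, lambda_set_eq κ hn]
  suffices {r | ∃ i y, DomF i (intCast (n + 2 • rhoK)) ∧
      IsChamberProj (posE i) (wt (shifted n i)) y ∧ r = wtNorm κ y} =
      {wtNorm κ (wt (shifted n j))} by rw [this, csInf_singleton]
  ext r
  rw [Set.mem_singleton_iff]
  constructor
  · rintro ⟨i, y, hi, hy, rfl⟩
    obtain rfl : i = j := by
      by_contra hij
      have h1 := h.dot_rhoF_lt hij
      rw [← intCast_add_two_rhoK] at h1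
      exact (hi.dot_rhoF_le j).not_gt h1
    rw [hy.eq_of_isDominant (isDominant_posE.2 h)]
  · rintro rfl
    exact ⟨j, _, domF_of_shifted h, isChamberProj_self (isDominant_posE.2 h), rfl⟩

/-- The spin norm and the lambda norm agree if and only if, for some `j`, `μ - ρ_n^(j)` is
`𝔨`-dominant and `μ + ρ_c - ρ_n^(j)` is dominant for the positive system `j`. -/
theorem spinNorm_eq_lambdaNorm_iff {κ : ℝ} (hκ : 0 < κ) {n : Fin 4 → ℤ} (hn : DomK (intCast n)) :
    spinNorm κ (wt n) = lambdaNorm κ (wt n) ↔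
      ∃ j, DomK (intCast (n - rhoN j)) ∧ DomF j (intCast (shifted n j)) := by
  constructor
  · intro heq
    obtain ⟨i, hi⟩ := spinNorm_attained κ n
    obtain ⟨j, hj⟩ := exists_domF (domK_of_strict hn)
    obtain ⟨y, hy⟩ := exists_isChamberProj (posE j) (wt (shifted n j))
    have h1 := lambdaNorm_le κ hn hj hy
    rw [← heq, hi, wtNorm,
      Real.sqrt_le_sqrt_iff (mul_nonneg hκ.le (real_form_nonneg y)), mul_le_mul_iff_right₀ hκ] at h1
    have h2 := hy.form_le
    have h3 := form_shifted_le hj i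
    have h4 := form_le_spinSq (intCast (n - rhoN i))
    rw [← wt_shifted] at h4
    -- The chain of inequalities closes up: the spin norm bounds the length of the unprojected
    -- vector from above and is itself at most that of the projection.
    have h5 : y = wt (shifted n j) := hy.eq_of_form_le (by linarith)
    have h6 : DomF j (intCast (shifted n j)) := isDominant_posE.1 (by
      have := hy.1
      rwa [h5] at this)
    obtain rfl : i = j := by
      by_contra hij
      have h7 := h6.dot_rhoF_lt hij
      rw [← intCast_add_two_rhoK] at h7
      have h8 := form_shifted n i
      have h9 := form_shifted n j
      linarith
    refine ⟨i, (form_eq_spinSq_iff _).1 ?_, h6⟩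
    rw [← wt_shifted]
    linarith
  · rintro ⟨j, hK, hF⟩
    have hs := (form_eq_spinSq_iff _).2 hK
    rw [← wt_shifted] at hs
    rw [lambdaNorm_of_shifted κ hn hF, wtNorm, hs]
    refine le_antisymm (spinNorm_le κ n j) ?_
    obtain ⟨i, hi⟩ := spinNorm_attained κ n
    rw [hi, ← hs]
    refine Real.sqrt_le_sqrt (mul_le_mul_of_nonneg_left ?_ hκ.le)
    refine (form_shifted_le (domF_of_shifted hF) i).trans ?_
    rw [wt_shifted]
    exact form_le_spinSq _

/-! ### The `K`-types -/

lemma mem_closure_rootsT {μ : Wt} : μ ∈ AddSubgroup.closure (rootsT ⊤) ↔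
    ∃ n : Fin 4 → ℤ, μ = wt n ∧ (n 0 + n 1 + n 2 + n 3) % 2 = 0 := by
  rw [rootsT_top]
  constructor
  · intro h
    induction h using AddSubgroup.closure_induction with
    | mem μ hμ =>
      obtain ⟨v, hv, rfl⟩ := hμ
      obtain ⟨α, rfl⟩ := exists_root_coord hv
      exact ⟨_, rfl, by simp [coord]; omega⟩
    | zero => exact ⟨0, (map_zero wtHom).symm, by simp⟩
    | add μ ν _ _ h1 h2 =>
      obtain ⟨n, rfl, hn⟩ := h1
      obtain ⟨m, rfl, hm⟩ := h2
      exact ⟨n + m, (wt_add n m).symm, by simp; omega⟩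
    | neg μ _ h =>
      obtain ⟨n, rfl, hn⟩ := h
      exact ⟨-n, (map_neg wtHom n).symm, by simp; omega⟩
  · rintro ⟨n, rfl, hn⟩
    obtain ⟨k, hk⟩ := Int.dvd_of_emod_eq_zero hn
    -- The lattice of integral vectors with even coordinate sum is spanned by the short roots `e_i -
    -- e_3` and the long root `2 e_3`, coordinates being counted from 0.
    have e : n = n 0 • ![1, 0, 0, -1] + n 1 • ![0, 1, 0, -1] + n 2 • ![0, 0, 1, -1] +
        k • ![0, 0, 0, 2] := by
      funext i; fin_cases i <;> simp; omega
    have key : ∀ v ∈ [![1, 0, 0, -1], ![0, 1, 0, -1], ![0, 0, 1, -1], ![0, 0, 0, 2]],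
        wtHom v ∈ AddSubgroup.closure (wt '' rootsF) := by
      intro v hv
      refine AddSubgroup.subset_closure ⟨v, Finset.mem_coe.2 (mem_rootsF.2 ?_), rfl⟩
      revert v; decide
    simp only [List.forall_mem_cons] at key
    obtain ⟨k0, k1, k2, k3, -⟩ := key
    change wtHom n ∈ _
    rw [e, map_add, map_add, map_add, map_zsmul, map_zsmul, map_zsmul, map_zsmul]
    exact add_mem (add_mem (add_mem (zsmul_mem k0 _) (zsmul_mem k1 _)) (zsmul_mem k2 _))
      (zsmul_mem k3 _)

/-- In these coordinates `ϖ_k` is the sum of the first `k` basis vectors. -/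
lemma weight_eq (p q r s : ℤ) :
    weight p q r s = wt ![p + q + r + s, q + r + s, r + s, s] := by
  funext i
  fin_cases i <;> simp [weight, wt, emb_apply, fundK, simpleK, simpleF] <;> ring

/-- The `K`-types are the `[p, q, r, s]` with natural numbers `p, q, r, s` such that `p + r` is
even. -/
lemma isKType_iff {μ : Wt} : IsKType μ ↔
    ∃ p q r s : ℕ, μ = weight p q r s ∧ (p + r) % 2 = 0 := by
  rw [IsKType, mem_closure_rootsT]
  constructor
  · rintro ⟨⟨n, rfl, hn⟩, hd⟩
    obtain ⟨h1, h2, h3, h4⟩ := isDominant_posK.1 hd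
    simp at h1 h2 h3 h4
    refine ⟨(n 0 - n 1).toNat, (n 1 - n 2).toNat, (n 2 - n 3).toNat, (n 3).toNat, ?_, by omega⟩
    rw [weight_eq]
    congr 1
    funext i
    fin_cases i <;> simp <;> omega
  · rintro ⟨p, q, r, s, rfl, h⟩
    rw [weight_eq]
    refine ⟨⟨_, rfl, by simp; omega⟩, isDominant_posK.2 ?_⟩
    refine ⟨?_, ?_, ?_, ?_⟩ <;> simp

lemma domK_weight (p q r s : ℕ) : DomK (intCast ![(p + q + r + s : ℤ), q + r + s, r + s, s]) := by
  refine ⟨?_, ?_, ?_, ?_⟩ <;> simp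

lemma domK_intCast {v : Fin 4 → ℤ} :
    DomK (intCast v) ↔ v 1 ≤ v 0 ∧ v 2 ≤ v 1 ∧ v 3 ≤ v 2 ∧ 0 ≤ v 3 := by
  simp [DomK]

lemma domF_intCast {j : Fin 3} {v : Fin 4 → ℤ} :
    DomF j (intCast v) ↔ ∀ i, 0 ≤ v ⬝ᵥ simpleRoot j i := by
  simp only [DomF, dot_intCast, Int.cast_nonneg_iff]

/-- The condition of `spinNorm_eq_lambdaNorm_iff` for the weight `[p, q, r, s]`. -/
lemma exists_dominance_iff (p q r s : ℕ) :
    (∃ j, DomK (intCast (![(p + q + r + s : ℤ), q + r + s, r + s, s] - rhoN j)) ∧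
      DomF j (intCast (shifted ![(p + q + r + s : ℤ), q + r + s, r + s, s] j))) ↔
    1 ≤ q ∧ 1 ≤ r ∧ 1 ≤ p ∧ (r + 2 * s + 6 ≤ p ∨
      (1 ≤ s ∧ r + 2 ≤ p ∧ p ≤ r + 2 * s + 2) ∨ p + 2 ≤ r) := by
  simp only [domK_intCast, domF_intCast, shifted, Fin.exists_fin_succ, Fin.forall_fin_succ,
    dot_four]
  -- The three disjuncts come from `j = 0, 1, 2`. Dominance of `μ - ρ_n^(j)` also asks for `p ≥ 5`,
  -- for `p ≥ 3` and for `r ≥ 3` respectively, but these follow from the listed inequalities.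
  simp [rhoN, rhoK, simpleRoot]
  omega

end EI

/-! ### From inequalities on `[p, q, r, s]` to the three families -/

theorem mainTheorem9 (κ : ℝ) (hκ : 0 < κ) :
    {μ : EI.Wt | EI.IsKType μ ∧ EI.spinNorm κ μ = EI.lambdaNorm κ μ} =
    {μ : EI.Wt | ∃ a b c d e f : ℕ,
      (a = f ∨ a = f + 1) ∧ (c = e ∨ c = e + 1) ∧ 1 ≤ a + f ∧ 1 ≤ c + e ∧ 1 ≤ b + d ∧
      (μ = EI.weight (c + 2 * d + e + 2) (a + f) (c + e) (b + d) ∨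
       (1 ≤ d ∧ μ = EI.weight (2 * b + c + 2 * d + e + 4) (a + f) (c + e) (d - 1)) ∨
       (1 ≤ b ∧ μ = EI.weight (c + e) (a + f) (c + 2 * d + e + 2) (b - 1)))} := by
  have hN : ∀ p q r s : ℕ, EI.spinNorm κ (EI.weight p q r s) = EI.lambdaNorm κ (EI.weight p q r s) ↔
      1 ≤ q ∧ 1 ≤ r ∧ 1 ≤ p ∧ (r + 2 * s + 6 ≤ p ∨
        (1 ≤ s ∧ r + 2 ≤ p ∧ p ≤ r + 2 * s + 2) ∨ p + 2 ≤ r) := fun p q r s => by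
    rw [← EI.exists_dominance_iff, EI.weight_eq,
      EI.spinNorm_eq_lambdaNorm_iff hκ (EI.domK_weight p q r s)]
  ext μ
  constructor
  · rintro ⟨hK, heq⟩
    obtain ⟨p, q, r, s, rfl, hpr⟩ := EI.isKType_iff.1 hK
    obtain ⟨hq, hr, hp, h⟩ := (hN p q r s).1 heq
    rcases h with h | ⟨hs, h1, h2⟩ | h
    -- The pairs `(a, f)` and `(c, e)` split a number into its rounded-up and rounded-down halves.
    -- Since `p + r` is even, the halved difference giving `b` is exact; the same holds for the
    -- halved difference of `p` and `r` in the other two cases.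
    · refine ⟨(q + 1) / 2, (p - r - 2 * s - 6) / 2, (r + 1) / 2, s + 1, r / 2, q / 2,
        by omega, by omega, by omega, by omega, by omega, Or.inr (Or.inl ⟨by omega, ?_⟩)⟩
      congr 1 <;> omega
    · refine ⟨(q + 1) / 2, s - (p - r - 2) / 2, (r + 1) / 2, (p - r - 2) / 2, r / 2, q / 2,
        by omega, by omega, by omega, by omega, by omega, Or.inl ?_⟩
      congr 1 <;> omega
    · refine ⟨(q + 1) / 2, s + 1, (p + 1) / 2, (r - p - 2) / 2, p / 2, q / 2,
        by omega, by omega, by omega, by omega, by omega, Or.inr (Or.inr ⟨by omega, ?_⟩)⟩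
      congr 1 <;> omega
  · rintro ⟨a, b, c, d, e, f, ha, hc, haf, hce, hbd, h⟩
    suffices ∃ p q r s : ℕ, μ = EI.weight p q r s ∧ (p + r) % 2 = 0 ∧
        1 ≤ q ∧ 1 ≤ r ∧ 1 ≤ p ∧ (r + 2 * s + 6 ≤ p ∨
          (1 ≤ s ∧ r + 2 ≤ p ∧ p ≤ r + 2 * s + 2) ∨ p + 2 ≤ r) by
      obtain ⟨p, q, r, s, rfl, hpr, h⟩ := this
      exact ⟨EI.isKType_iff.2 ⟨p, q, r, s, rfl, hpr⟩, (hN p q r s).2 h⟩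
    rcases h with rfl | ⟨hd, rfl⟩ | ⟨hb, rfl⟩
    · exact ⟨c + 2 * d + e + 2, a + f, c + e, b + d, by push_cast; rfl, by omega⟩
    · refine ⟨2 * b + c + 2 * d + e + 4, a + f, c + e, d - 1, ?_, by omega⟩
      -- The entry `d - 1` of the weight is an integer subtraction; `1 ≤ d` identifies it with the
      -- truncated one of the witness.
      rw [Nat.cast_sub hd]; push_cast; rfl
    · refine ⟨c + e, a + f, c + 2 * d + e + 2, b - 1, ?_, by omega⟩
      rw [Nat.cast_sub hb]; push_cast; rfl
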